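/- Let $X=\operatorname{SL}_2(\mathbb R)/\operatorname{SL}_2(\mathbb Z)$ be the space of unimodular lattices in $\mathbb R^2$ (where $g\operatorname{SL}_2(\mathbb Z)$ is identified with the lattice $g\mathbb Z^2$), with the quotient topology. Put $g_t=\begin{pmatrix} e^t&0\\0&e^{-t}\end{pmatrix}$ for $t\in\mathbb R$ and $g_{\mathbb R}\Lambda=\{g_t\Lambda: t\in\mathbb R\}$, and for $\alpha\in\mathbb R$ let $\Lambda_\alpha=\begin{pmatrix}1&\alpha\\0&1\end{pmatrix}\mathbb Z^2$. Let $\nu$ be a norm on $\mathbb R^2$, let $B_\nu(r)=\{v:\nu(v)<r\}$, and define $$r_\nu=\sup\{r\in\mathbb R:\ \Lambda\cap B_\nu(r)=\{0\}\text{ for some }\Lambda\in X\},\qquad \mathcal L_\nu=\{\Lambda\in X:\ \Lambda\cap B_\nu(r_\nu)=\{0\}\}$$ (the critical radius and the critical locus of $\nu$). Let $\mathbf{DI}_\nu$ be the set of $\alpha\in\mathbb R$ for which there is $c\in(0,1)$ such that $$\Lambda_\alpha\cap\begin{pmatrix} cT^{-1}&0\\0&T\end{pmatrix}B_\nu(r_\nu)\neq\{0\}\quad\text{for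 all sufficiently large } T,$$ and let $\mathbf{BA}$ be the set of badly approximable numbers, that is, of irrational real numbers whose continued fraction digits are bounded. If $\mathcal L_\nu$ contains a lattice $\Lambda$ such that $g_{\mathbb R}\Lambda$ is precompact (has compact closure) in $X$, then $\mathbf{BA}\smallsetminus\mathbf{DI}_\nu$ has full Hausdorff dimension, i.e. Hausdorff dimension $1$. Conversely, if $\mathcal L_\nu$ contains no such lattice, then $\mathbf{BA}\subset\mathbf{DI}_\nu$. -/

import Mathlib

open scoped Matrix

namespace NormDirichlet

noncomputable section

/-- `SL₂(ℝ)`. -/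
abbrev G : Type := Matrix.SpecialLinearGroup (Fin 2) ℝ

/-- `SL₂(ℤ)`, as a subgroup of `SL₂(ℝ)`. -/
def Γ : Subgroup G :=
  (Matrix.SpecialLinearGroup.map (n := Fin 2) (Int.castRingHom ℝ)).range

/-- The space of unimodular lattices in `ℝ²`, identified with `SL₂(ℝ) / SL₂(ℤ)` through
`g ↦ g ℤ²`; it carries the quotient topology and the left action of `SL₂(ℝ)`. -/
abbrev X : Type := G ⧸ Γ

/-- The lattice `g ℤ²`, as a set of vectors. -/
def latticeOf (g : G) : Set (Fin 2 → ℝ) :=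
  Set.range fun m : Fin 2 → ℤ => (g : Matrix (Fin 2) (Fin 2) ℝ) *ᵥ fun i => (m i : ℝ)

lemma latticeOf_mul_subset (g : G) (γ : Matrix.SpecialLinearGroup (Fin 2) ℤ) :
    latticeOf (g * Matrix.SpecialLinearGroup.map (Int.castRingHom ℝ) γ) ⊆ latticeOf g := by
  rintro _ ⟨m, rfl⟩
  refine ⟨(γ : Matrix (Fin 2) (Fin 2) ℤ) *ᵥ m, ?_⟩
  simp only [Matrix.SpecialLinearGroup.coe_mul, ← Matrix.mulVec_mulVec]
  congr 1
  ext i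
  simp [Matrix.mulVec, dotProduct]

lemma latticeOf_eq_of_rel (g h : G) (hgh : (QuotientGroup.leftRel Γ) g h) :
    latticeOf g = latticeOf h := by
  rw [QuotientGroup.leftRel_apply] at hgh
  obtain ⟨γ, hγ⟩ := hgh
  have hh : h = g * Matrix.SpecialLinearGroup.map (Int.castRingHom ℝ) γ := by
    rw [hγ]; group
  have hg : g = h * Matrix.SpecialLinearGroup.map (Int.castRingHom ℝ) γ⁻¹ := by
    rw [map_inv, hγ]; group
  apply Set.Subset.antisymm
  · rw [hg]; exact latticeOf_mul_subset h γ⁻¹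
  · rw [hh]; exact latticeOf_mul_subset g γ

/-- The set of vectors of the unimodular lattice `Λ`. -/
def vectors (Λ : X) : Set (Fin 2 → ℝ) :=
  Quotient.lift latticeOf latticeOf_eq_of_rel Λ

/-- Two points of `SL₂(ℝ) / SL₂(ℤ)` with the same vectors are equal, so that
points of `X` are the same thing as lattices `g ℤ²`. -/
theorem vectors_injective : Function.Injective vectors := by
  intro x y
  induction x using QuotientGroup.induction_on with
  | H g =>
  induction y using QuotientGroup.induction_on with
  | H h =>
  intro e
  change latticeOf g = latticeOf h at e
  have key : ∀ j : Fin 2, ∃ m : Fin 2 → ℤ, ∀ i,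
      ((g⁻¹ * h : G) : Matrix (Fin 2) (Fin 2) ℝ) i j = (m i : ℝ) := by
    intro j
    have hj : (h : Matrix (Fin 2) (Fin 2) ℝ) *ᵥ (fun i => ((Pi.single j 1 : Fin 2 → ℤ) i : ℝ))
        ∈ latticeOf g := by
      rw [e]; exact ⟨_, rfl⟩
    obtain ⟨m, hm⟩ := hj
    refine ⟨m, fun i => ?_⟩
    have h2 := congrArg (fun v => ((g⁻¹ : G) : Matrix (Fin 2) (Fin 2) ℝ) *ᵥ v) hm
    simp only [Matrix.mulVec_mulVec, ← Matrix.SpecialLinearGroup.coe_mul, inv_mul_cancel] at h2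
    have h3 := congrFun h2 i
    have h4 : (fun i => ((Pi.single j 1 : Fin 2 → ℤ) i : ℝ)) = Pi.single j 1 := by
      ext k; by_cases hk : k = j
      · subst hk; simp
      · simp [hk]
    rw [h4, Matrix.mulVec_single_one] at h3
    simpa using h3.symm
  choose m hm using key
  have hdet : (Matrix.of fun i j => m j i).det = 1 := by
    have h1 := (g⁻¹ * h : G).det_coe
    rw [Matrix.det_fin_two, hm, hm, hm, hm] at h1
    rw [Matrix.det_fin_two]
    simp only [Matrix.of_apply]
    exact_mod_cast h1
  apply QuotientGroup.eq.mpr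
  refine ⟨⟨Matrix.of fun i j => m j i, hdet⟩, ?_⟩
  ext i j
  rw [hm j i]
  rfl

/-- The diagonal one-parameter subgroup `g_t = diag(e^t, e^{-t})`. -/
def diagFlow (t : ℝ) : G :=
  ⟨!![Real.exp t, 0; 0, Real.exp (-t)], by simp [Matrix.det_fin_two, ← Real.exp_add]⟩

/-- The full orbit `g_ℝ Λ` has compact closure in `X`. -/
def HasPrecompactOrbit (Λ : X) : Prop :=
  IsCompact (closure (Set.range fun t : ℝ => diagFlow t • Λ))

/-- The unipotent matrix with rows `(1, α)` and `(0, 1)`. -/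
def unip (α : ℝ) : G :=
  ⟨!![1, α; 0, 1], by simp [Matrix.det_fin_two]⟩

/-- The lattice `Λ_α`. -/
def latticeAt (α : ℝ) : X := QuotientGroup.mk (unip α)

/-- The critical radius `r_ν`: the supremum of the `r` for which some unimodular lattice meets
the open ball `B_ν(r)` only in the origin. -/
def criticalRadius (ν : Seminorm ℝ (Fin 2 → ℝ)) : ℝ :=
  sSup {r : ℝ | ∃ Λ : X, vectors Λ ∩ ν.ball 0 r = {0}}

/-- The critical locus `L_ν`. -/
def criticalLocus (ν : Seminorm ℝ (Fin 2 → ℝ)) : Set X :=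
  {Λ : X | vectors Λ ∩ ν.ball 0 (criticalRadius ν) = {0}}

/-- The set `DI_ν` of `ν`-Dirichlet improvable real numbers. -/
def DI (ν : Seminorm ℝ (Fin 2 → ℝ)) : Set ℝ :=
  {α : ℝ | ∃ c : ℝ, 0 < c ∧ c < 1 ∧ ∃ T₀ : ℝ, 0 < T₀ ∧ ∀ T : ℝ, T₀ ≤ T →
    vectors (latticeAt α) ∩
      (fun v : Fin 2 → ℝ => !![c * T⁻¹, 0; 0, T] *ᵥ v) '' ν.ball 0 (criticalRadius ν) ≠ {0}}

/-- The set of badly approximable real numbers: the irrational numbers whose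
regular continued fraction has bounded digits. -/
def BA : Set ℝ :=
  {α : ℝ | Irrational α ∧ ∃ M : ℝ, ∀ (n : ℕ) (a : ℝ),
    (GenContFract.of α).partDens.get? n = some a → a ≤ M}

end

end NormDirichlet

/-!
The flow `g_t = diagFlow t` translates both sets into dynamics. A number `α` is badly approximable
exactly when the forward orbit `g_s Λ_α`, `s ≥ 0`, stays in a compact part of `X` (`mem_BA_iff`,
resting on Legendre's theorem and on Mahler's criterion `isCompact_setOf_longVectors`), and it fails
to be `ν`-Dirichlet improvable exactly when this orbit comes arbitrarily close to the critical locus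
at arbitrarily late times (`not_mem_DI_iff`).

If `α` lies in `BA` but not in `DI ν`, a limit point of its orbit along such times is therefore a
critical lattice, and the whole orbit of that lattice consists of limit points of a bounded orbit;
hence it is precompact (`exists_criticalLocus_of_mem_BA_diff_DI`). This is the second half.

For the first half, let `Λ` be a critical lattice with bounded orbit. A Cantor set of dimension close
to `1` is built inside `BA \ DI ν`. Call an interval of length `e^{-2t}` good if none of its points
`α` gives a lattice `g_t Λ_α` with an `ε`-short vector.
* Of the `8M` equal subintervals of a good interval, at least `M` separated ones are good again,
  because the vectors that become short at the next stage are all collinear (`exists_branching`).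
* A good interval also contains a much smaller good one on which the orbits follow that of `Λ` for a
  long time and pass very close to `Λ` (`exists_shadowing`). The reason is that any two lattices in a
  compact set are joined, in bounded time, by a heteroclinic connection (`exists_connection`); this
  comes from the density of the `SL₂(ℤ)`-orbits of directions together with compactness.

Branching at each step, and shadowing for longer and longer times at the very sparse steps that
precede powers of two, gives a point for each sequence of `M` digits. Its orbit is bounded and
accumulates at `Λ`. Reading the digits in base `M` maps the set of these points onto `[0, 1]` by a
Hölder function whose exponent is any number less than `log M / log (8M)`, as the shadowings occupy a
vanishing proportion of the total time (`le_dimH_range_of_digits`). So the dimension is at least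
every such exponent, and these tend to `1` as `M → ∞`.
-/

namespace NormDirichlet

/-! ### Badly approximable numbers and continued fractions -/

lemma exists_int_contsAux (v : ℝ) (n : ℕ) :
    ∃ a b : ℤ, ((GenContFract.of v).contsAux n).a = a ∧ ((GenContFract.of v).contsAux n).b = b := by
  induction n using Nat.twoStepInduction with
  | zero => exact ⟨1, 0, by simp [GenContFract.contsAux]⟩
  | one => exact ⟨⌊v⌋, 1, by simp [GenContFract.contsAux]⟩
  | more n ih₀ ih₁ =>
    by_cases ht : (GenContFract.of v).TerminatedAt n
    · rwa [GenContFract.contsAux_stable_step_of_terminated ht]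
    · obtain ⟨gp, hgp⟩ := Option.ne_none_iff_exists'.1 ht
      obtain ⟨ha, z, hz⟩ := GenContFract.of_partNum_eq_one_and_exists_int_partDen_eq hgp
      obtain ⟨a₀, b₀, ha₀, hb₀⟩ := ih₀
      obtain ⟨a₁, b₁, ha₁, hb₁⟩ := ih₁
      rw [GenContFract.contsAux_recurrence hgp rfl rfl]
      refine ⟨z * a₁ + a₀, z * b₁ + b₀, ?_, ?_⟩
      · simp [ha, hz, ha₀, ha₁]
      · simp [ha, hz, hb₀, hb₁]

lemma not_terminatedAt_of_irrational {α : ℝ} (hα : Irrational α) (n : ℕ) :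
    ¬ (GenContFract.of α).TerminatedAt n := by
  intro h
  obtain ⟨q, hq⟩ := (GenContFract.terminates_iff_rat α).1 ⟨n, h⟩
  exact hα ⟨q, hq.symm⟩

lemma contsAux_b_pos {α : ℝ} (hα : Irrational α) (n : ℕ) :
    0 < ((GenContFract.of α).contsAux (n + 1)).b := by
  have h := GenContFract.fib_le_of_contsAux_b (v := α) (n := n + 1)
    (Or.inr (not_terminatedAt_of_irrational hα _))
  have : 0 < Nat.fib (n + 1) := Nat.fib_pos.2 n.succ_pos
  exact lt_of_lt_of_le (by exact_mod_cast this) h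

/-- The denominator of the `n`-th convergent in lowest terms is no less than the one given by the
recurrence: consecutive continuants have determinant `±1`, so the latter divides the former. -/
lemma dens_le_den {α : ℝ} (hα : Irrational α) {n : ℕ} {r : ℚ}
    (hr : (GenContFract.of α).convs n = r) :
    ((GenContFract.of α).contsAux (n + 1)).b ≤ r.den := by
  obtain ⟨a, b, ha, hb⟩ := exists_int_contsAux α (n + 1)
  obtain ⟨a', b', ha', hb'⟩ := exists_int_contsAux α n
  have hbpos := contsAux_b_pos hα n
  have hdet : (a' * b - b' * a : ℤ) = (-1) ^ n := by
    have : (a' * b - b' * a : ℝ) = (-1) ^ n := by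
      rw [← ha, ← hb, ← ha', ← hb']
      cases n with
      | zero => simp [GenContFract.contsAux]
      | succ n =>
        exact (SimpContFract.of α).determinant (not_terminatedAt_of_irrational hα n)
    exact_mod_cast this
  have hab : (a : ℝ) * r.den = r.num * b := by
    have h1 : (GenContFract.of α).convs n = a / b := by
      rw [← ha, ← hb]; rfl
    rw [hb] at hbpos
    have h2 : (r : ℝ) = r.num / r.den := by exact_mod_cast (Rat.num_div_den r).symm
    have h3 : (0 : ℝ) < r.den := by exact_mod_cast r.den_pos
    rw [h1, h2, div_eq_div_iff hbpos.ne' h3.ne'] at hr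
    exact hr
  have hab' : a * (r.den : ℤ) = r.num * b := by exact_mod_cast hab
  have hdvd : b ∣ (r.den : ℤ) := by
    have : b * (a' * r.den - b' * r.num) = (-1) ^ n * (r.den : ℤ) := by
      rw [← hdet]; linear_combination (b' : ℤ) * hab'
    have h4 : b ∣ (-1) ^ n * (r.den : ℤ) := ⟨_, this.symm⟩
    have h5 := h4.mul_left ((-1) ^ n)
    rwa [← mul_assoc, ← pow_add, ← two_mul, pow_mul, neg_one_sq, one_pow, one_mul] at h5
  rw [hb]
  exact_mod_cast Int.le_of_dvd (by exact_mod_cast r.den_pos) hdvd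

/-- A badly approximable number admits no good rational approximations. By Legendre's theorem it
suffices to bound the quality of the convergents, which the next digit controls. -/
lemma exists_le_mul_abs_of_mem_BA {α : ℝ} (h : α ∈ BA) :
    ∃ c : ℝ, 0 < c ∧ ∀ p q : ℤ, q ≠ 0 → c ≤ |(q : ℝ)| * |p + α * q| := by
  obtain ⟨hα, M, hM⟩ := h
  have key : ∀ r : ℚ, 1 / (|M| + 2) ≤ (r.den : ℝ) ^ 2 * |α - r| := by
    intro r
    have hd : (0 : ℝ) < r.den := by exact_mod_cast r.den_pos
    by_cases hr : |α - r| < 1 / (2 * (r.den : ℝ) ^ 2)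
    · obtain ⟨n, hn⟩ := Real.exists_convs_eq_rat hr
      have hB := contsAux_b_pos hα n
      have hBd := dens_le_den hα hn
      obtain ⟨gp, hgp⟩ := Option.ne_none_iff_exists'.1 (not_terminatedAt_of_irrational hα n)
      obtain ⟨i1, hi1, hb⟩ :=
        GenContFract.IntFractPair.exists_succ_get?_stream_of_gcf_of_get?_eq_some hgp
      obtain ⟨i0, hi0, hfr, hi⟩ := GenContFract.IntFractPair.succ_nth_stream_eq_some_iff.1 hi1
      have hle : gp.b ≤ M := hM n _ (GenContFract.partDen_eq_s_b hgp)
      have hfl : i0.fr⁻¹ ≤ |M| + 1 := by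
        have h1 : (i1.b : ℝ) = ⌊i0.fr⁻¹⌋ := by rw [← hi]; rfl
        have h2 := (Int.lt_floor_add_one i0.fr⁻¹).le
        have h3 := le_abs_self M
        linarith
      have hsub := GenContFract.sub_convs_eq hi0
      simp only [if_neg hfr] at hsub
      rw [hn] at hsub
      set B := ((GenContFract.of α).contsAux (n + 1)).b with hBdef
      set B' := ((GenContFract.of α).contsAux n).b with hBdef'
      have hB'0 : 0 ≤ B' := GenContFract.zero_le_of_contsAux_b
      have hB'B : B' ≤ B := by
        cases n with
        | zero => simp [hBdef', hBdef, GenContFract.contsAux]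
        | succ n =>
          have := GenContFract.of_den_mono (v := α) (n := n)
          simpa [GenContFract.den_eq_conts_b, GenContFract.nth_cont_eq_succ_nth_contAux] using this
      have hfr0 : 0 < i0.fr⁻¹ := inv_pos.2
        (lt_of_le_of_ne (GenContFract.IntFractPair.nth_stream_fr_nonneg hi0) (Ne.symm hfr))
      have hden : B * (i0.fr⁻¹ * B + B') ≤ (r.den : ℝ) ^ 2 * (|M| + 2) := by
        have : B * (i0.fr⁻¹ * B + B') ≤ B * ((|M| + 1) * B + B) := by gcongr
        have h2 : B * ((|M| + 1) * B + B) = B ^ 2 * (|M| + 2) := by ring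
        have h3 : B ^ 2 ≤ (r.den : ℝ) ^ 2 := by gcongr
        have h4 : 0 ≤ |M| + 2 := by positivity
        nlinarith
      rw [hsub, abs_div, abs_pow, abs_neg, abs_one, one_pow]
      have hpos : 0 < B * (i0.fr⁻¹ * B + B') := by positivity
      rw [abs_of_pos hpos, mul_one_div, div_le_div_iff₀ (by positivity) hpos]
      linarith
    · rw [not_lt] at hr
      have h1 : (r.den : ℝ) ^ 2 * (1 / (2 * (r.den : ℝ) ^ 2)) = 1 / 2 := by field_simp
      have h2 : (r.den : ℝ) ^ 2 * (1 / (2 * (r.den : ℝ) ^ 2)) ≤ (r.den : ℝ) ^ 2 * |α - r| := by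
        gcongr
      have h3 : 1 / (|M| + 2) ≤ 1 / 2 := by
        apply one_div_le_one_div_of_le (by norm_num)
        linarith [abs_nonneg M]
      linarith
  refine ⟨1 / (|M| + 2), by positivity, fun p q hq => ?_⟩
  have hqR : (q : ℝ) ≠ 0 := by exact_mod_cast hq
  set r : ℚ := (-p : ℤ) / q with hr
  have h1 := key r
  have hdq : (r.den : ℝ) ≤ |(q : ℝ)| := by
    have h2 : (r.den : ℤ) ∣ q := by
      rw [hr, ← Rat.divInt_eq_div]; exact Rat.den_dvd (-p) q
    have h3 := Int.le_of_dvd (abs_pos.2 hq) ((dvd_abs _ _).2 h2)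
    exact_mod_cast h3
  have h4 : |(q : ℝ)| * |p + α * q| = |(q : ℝ)| ^ 2 * |α - r| := by
    have h5 : (p + α * q : ℝ) = q * (α - r) := by
      rw [hr]; push_cast; field_simp; ring
    rw [h5, abs_mul]; ring
  rw [h4]
  refine h1.trans ?_
  gcongr

/-- A real number without good rational approximations is badly approximable: a large digit would
make the preceding convergent a good approximation. -/
lemma mem_BA_of_le_mul_abs {α c : ℝ} (hc : 0 < c)
    (h : ∀ p q : ℤ, q ≠ 0 → c ≤ |(q : ℝ)| * |p + α * q|) : α ∈ BA := by
  have hα : Irrational α := by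
    rintro ⟨r, rfl⟩
    have := h (-r.num) r.den (by exact_mod_cast r.den_ne_zero)
    have h2 : ((-r.num : ℤ) : ℝ) + (r : ℝ) * ((r.den : ℤ) : ℝ) = 0 := by
      have h3 : (r : ℚ) * r.den = r.num := Rat.mul_den_eq_num r
      have h4 : (r : ℝ) * r.den = r.num := by exact_mod_cast h3
      push_cast; linarith
    rw [h2] at this
    simp at this; linarith
  refine ⟨hα, 1 / c, fun n a ha => ?_⟩
  have h1 := GenContFract.abs_sub_convs_le (not_terminatedAt_of_irrational hα n)
  have h2 := GenContFract.le_of_succ_get?_den ha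
  obtain ⟨A, B, hA, hB⟩ := exists_int_contsAux α (n + 1)
  have hBpos := contsAux_b_pos hα n
  have ha1 := GenContFract.of_one_le_get?_partDen ha
  have hden : (GenContFract.of α).dens n = B := hB
  have hconv : (GenContFract.of α).convs n = A / B := by rw [← hA, ← hB]; rfl
  rw [hB] at hBpos
  rw [hden] at h1 h2
  rw [hconv] at h1
  have h3 := h (-A) B (by rintro rfl; simp at hBpos)
  have h4 : |(B : ℝ)| * |((-A : ℤ) : ℝ) + α * B| = B ^ 2 * |α - A / B| := by
    have : ((-A : ℤ) : ℝ) + α * B = B * (α - A / B) := by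
      push_cast; field_simp; ring
    rw [this, abs_mul, abs_of_pos hBpos]; ring
  rw [h4] at h3
  have h5 : |α - A / B| ≤ 1 / (B * (a * B)) := by
    refine h1.trans ?_
    apply one_div_le_one_div_of_le
    · have : 0 < a := by linarith
      positivity
    · gcongr
  have h6 : (B : ℝ) ^ 2 * |α - A / B| ≤ B ^ 2 * (1 / (B * (a * B))) := by gcongr
  have h7 : (B : ℝ) ^ 2 * (1 / (B * (a * B))) = 1 / a := by
    have : a ≠ 0 := by linarith
    field_simp
  rw [le_div_iff₀ hc]
  have : c ≤ 1 / a := by linarith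
  rw [le_div_iff₀ (by linarith)] at this
  linarith

/-! ### Lattices without short vectors -/

/-- The unipotent matrix with rows `(1, 0)` and `(y, 1)`, which `diagFlow` contracts. -/
noncomputable def lowUnip (y : ℝ) : G :=
  ⟨!![1, 0; y, 1], by simp [Matrix.det_fin_two]⟩

lemma norm_eq_max (v : Fin 2 → ℝ) : ‖v‖ = max |v 0| |v 1| := by
  apply le_antisymm
  · rw [pi_norm_le_iff_of_nonneg (by positivity), Fin.forall_fin_two]
    exact ⟨le_max_left _ _, le_max_right _ _⟩
  · exact max_le (norm_le_pi_norm v 0) (norm_le_pi_norm v 1)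

lemma mulVec_apply_zero (g : Matrix (Fin 2) (Fin 2) ℝ) (v : Fin 2 → ℝ) :
    (g *ᵥ v) 0 = g 0 0 * v 0 + g 0 1 * v 1 := by
  simp [Matrix.mulVec, dotProduct, Fin.sum_univ_two]

lemma mulVec_apply_one (g : Matrix (Fin 2) (Fin 2) ℝ) (v : Fin 2 → ℝ) :
    (g *ᵥ v) 1 = g 1 0 * v 0 + g 1 1 * v 1 := by
  simp [Matrix.mulVec, dotProduct, Fin.sum_univ_two]

lemma diagFlow_mulVec (t : ℝ) (v : Fin 2 → ℝ) :
    (diagFlow t : Matrix (Fin 2) (Fin 2) ℝ) *ᵥ v = ![Real.exp t * v 0, Real.exp (-t) * v 1] := by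
  ext i; fin_cases i <;> simp [diagFlow, mulVec_apply_zero, mulVec_apply_one]

lemma unip_mulVec (x : ℝ) (v : Fin 2 → ℝ) :
    (unip x : Matrix (Fin 2) (Fin 2) ℝ) *ᵥ v = ![v 0 + x * v 1, v 1] := by
  ext i; fin_cases i <;> simp [unip, mulVec_apply_zero, mulVec_apply_one]

lemma lowUnip_mulVec (y : ℝ) (v : Fin 2 → ℝ) :
    (lowUnip y : Matrix (Fin 2) (Fin 2) ℝ) *ᵥ v = ![v 0, y * v 0 + v 1] := by
  ext i; fin_cases i <;> simp [lowUnip, mulVec_apply_zero, mulVec_apply_one]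

lemma coe_diagFlow (t : ℝ) :
    (diagFlow t : Matrix (Fin 2) (Fin 2) ℝ) = !![Real.exp t, 0; 0, Real.exp (-t)] := rfl

lemma coe_unip (x : ℝ) : (unip x : Matrix (Fin 2) (Fin 2) ℝ) = !![1, x; 0, 1] := rfl

lemma coe_lowUnip (y : ℝ) : (lowUnip y : Matrix (Fin 2) (Fin 2) ℝ) = !![1, 0; y, 1] := rfl

lemma diagFlow_mul_diagFlow (s t : ℝ) : diagFlow s * diagFlow t = diagFlow (s + t) := by
  apply Subtype.ext
  simp [coe_diagFlow, ← Real.exp_add, add_comm]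

lemma diagFlow_zero : diagFlow 0 = 1 := by
  apply Subtype.ext
  simp [coe_diagFlow, Matrix.one_fin_two]

lemma unip_mul_unip (x y : ℝ) : unip x * unip y = unip (x + y) := by
  apply Subtype.ext
  simp [coe_unip, add_comm]

lemma unip_zero : unip 0 = 1 := by
  apply Subtype.ext
  simp [coe_unip, Matrix.one_fin_two]

lemma diagFlow_mul_unip (t x : ℝ) :
    diagFlow t * unip x = unip (Real.exp (2 * t) * x) * diagFlow t := by
  have h : Real.exp t = Real.exp (2 * t) * Real.exp (-t) := by
    rw [← Real.exp_add]; ring_nf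
  apply Subtype.ext
  simp only [Matrix.SpecialLinearGroup.coe_mul, coe_diagFlow, coe_unip]
  ext i j
  fin_cases i <;> fin_cases j <;> simp
  rw [h]; ring

lemma diagFlow_mul_lowUnip (t y : ℝ) :
    diagFlow t * lowUnip y = lowUnip (Real.exp (-2 * t) * y) * diagFlow t := by
  have h : Real.exp (-t) = Real.exp (-2 * t) * Real.exp t := by
    rw [← Real.exp_add]; ring_nf
  apply Subtype.ext
  simp only [Matrix.SpecialLinearGroup.coe_mul, coe_diagFlow, coe_lowUnip]
  ext i j
  fin_cases i <;> fin_cases j <;> simp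
  rw [h]; ring_nf

lemma vectors_smul (h : G) (Λ : X) :
    vectors (h • Λ) = (fun v => (h : Matrix (Fin 2) (Fin 2) ℝ) *ᵥ v) '' vectors Λ := by
  induction Λ using QuotientGroup.induction_on with
  | H g =>
  change latticeOf (h * g) = _ '' latticeOf g
  simp only [latticeOf, ← Set.range_comp]
  congr 1
  ext m : 1
  simp only [Function.comp_apply, Matrix.SpecialLinearGroup.coe_mul, Matrix.mulVec_mulVec]

lemma zero_mem_vectors (Λ : X) : (0 : Fin 2 → ℝ) ∈ vectors Λ := by
  induction Λ using QuotientGroup.induction_on with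
  | H g =>
  exact ⟨0, by ext i; fin_cases i <;> simp [mulVec_apply_zero, mulVec_apply_one]⟩

/-- `Λ` has no nonzero vector of sup norm less than `ε`. -/
def LongVectors (ε : ℝ) (Λ : X) : Prop :=
  ∀ v ∈ vectors Λ, v ≠ 0 → ε ≤ ‖v‖

lemma LongVectors.mono {ε ε' : ℝ} {Λ : X} (h : LongVectors ε Λ) (hε : ε' ≤ ε) :
    LongVectors ε' Λ :=
  fun v hv h0 => hε.trans (h v hv h0)

lemma LongVectors.smul {ε K : ℝ} {Λ : X} {g : G} (h : LongVectors ε Λ) (hK : 0 < K)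
    (hg : ∀ v, ‖v‖ ≤ K * ‖(g : Matrix (Fin 2) (Fin 2) ℝ) *ᵥ v‖) : LongVectors (ε / K) (g • Λ) := by
  intro v hv h0
  rw [vectors_smul] at hv
  obtain ⟨w, hw, rfl⟩ := hv
  rw [div_le_iff₀' hK]
  refine (h w hw ?_).trans (hg w)
  rintro rfl
  exact h0 (by simp)

lemma norm_le_mul_norm_diagFlow (t : ℝ) (v : Fin 2 → ℝ) :
    ‖v‖ ≤ Real.exp |t| * ‖(diagFlow t : Matrix (Fin 2) (Fin 2) ℝ) *ᵥ v‖ := by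
  rw [diagFlow_mulVec, norm_eq_max, norm_eq_max, mul_max_of_nonneg _ _ (Real.exp_pos _).le]
  simp only [Matrix.cons_val_zero, Matrix.cons_val_one, abs_mul, Real.abs_exp, ← mul_assoc,
    ← Real.exp_add]
  apply max_le_max
  · have : 1 ≤ Real.exp (|t| + t) := Real.one_le_exp (by linarith [neg_abs_le t])
    nlinarith [abs_nonneg (v 0)]
  · have : 1 ≤ Real.exp (|t| + -t) := Real.one_le_exp (by linarith [le_abs_self t])
    nlinarith [abs_nonneg (v 1)]

lemma norm_le_mul_norm_unip (x : ℝ) (v : Fin 2 → ℝ) :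
    ‖v‖ ≤ (1 + |x|) * ‖(unip x : Matrix (Fin 2) (Fin 2) ℝ) *ᵥ v‖ := by
  rw [unip_mulVec, norm_eq_max, norm_eq_max]
  simp only [Matrix.cons_val_zero, Matrix.cons_val_one]
  set m := max |v 0 + x * v 1| |v 1|
  have h1 : |v 0 + x * v 1| ≤ m := le_max_left _ _
  have h2 : |v 1| ≤ m := le_max_right _ _
  have h3 : |v 0| ≤ |v 0 + x * v 1| + |x| * |v 1| := by
    rw [← abs_mul]
    simpa using abs_sub (v 0 + x * v 1) (x * v 1)
  have h4 : |x| * |v 1| ≤ |x| * m := by gcongr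
  have h5 : 0 ≤ |x| * m := (by positivity : 0 ≤ |x| * |v 1|).trans h4
  exact max_le (by linarith) (by linarith)

lemma norm_le_mul_norm_lowUnip (y : ℝ) (v : Fin 2 → ℝ) :
    ‖v‖ ≤ (1 + |y|) * ‖(lowUnip y : Matrix (Fin 2) (Fin 2) ℝ) *ᵥ v‖ := by
  rw [lowUnip_mulVec, norm_eq_max, norm_eq_max]
  simp only [Matrix.cons_val_zero, Matrix.cons_val_one]
  set m := max |v 0| |y * v 0 + v 1|
  have h1 : |v 0| ≤ m := le_max_left _ _
  have h2 : |y * v 0 + v 1| ≤ m := le_max_right _ _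
  have h3 : |v 1| ≤ |y * v 0 + v 1| + |y| * |v 0| := by
    rw [← abs_mul]
    simpa using abs_sub (y * v 0 + v 1) (y * v 0)
  have h4 : |y| * |v 0| ≤ |y| * m := by gcongr
  have h5 : 0 ≤ |y| * m := (by positivity : 0 ≤ |y| * |v 0|).trans h4
  exact max_le (by linarith) (by linarith)

lemma LongVectors.diagFlow_smul {ε : ℝ} {Λ : X} (h : LongVectors ε Λ) (t : ℝ) :
    LongVectors (ε / Real.exp |t|) (diagFlow t • Λ) :=
  h.smul (Real.exp_pos _) (norm_le_mul_norm_diagFlow t)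

lemma LongVectors.unip_smul {ε : ℝ} {Λ : X} (h : LongVectors ε Λ) (x : ℝ) :
    LongVectors (ε / (1 + |x|)) (unip x • Λ) :=
  h.smul (by positivity) (norm_le_mul_norm_unip x)

lemma LongVectors.lowUnip_smul {ε : ℝ} {Λ : X} (h : LongVectors ε Λ) (y : ℝ) :
    LongVectors (ε / (1 + |y|)) (lowUnip y • Λ) :=
  h.smul (by positivity) (norm_le_mul_norm_lowUnip y)

lemma mem_vectors_latticeAt {α : ℝ} {v : Fin 2 → ℝ} :
    v ∈ vectors (latticeAt α) ↔ ∃ p q : ℤ, v = ![p + α * q, (q : ℝ)] := by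
  constructor
  · rintro ⟨m, rfl⟩
    exact ⟨m 0, m 1, unip_mulVec _ _⟩
  · rintro ⟨p, q, rfl⟩
    exact ⟨![p, q], (unip_mulVec _ _).trans (by simp)⟩

lemma unip_smul_latticeAt (x α : ℝ) : unip x • latticeAt α = latticeAt (x + α) := by
  change QuotientGroup.mk (unip x * unip α) = _
  rw [unip_mul_unip]; rfl

/-- Dani's correspondence: `α` is badly approximable exactly when the forward orbit of `Λ_α` stays
away from the cusp. -/
lemma mem_BA_iff {α : ℝ} :
    α ∈ BA ↔ ∃ ε : ℝ, 0 < ε ∧ ∀ s : ℝ, 0 ≤ s → LongVectors ε (diagFlow s • latticeAt α) := by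
  constructor
  · intro h
    obtain ⟨c, hc, hα⟩ := exists_le_mul_abs_of_mem_BA h
    refine ⟨min 1 √c, by positivity, fun s hs v hv hv0 => ?_⟩
    rw [vectors_smul] at hv
    obtain ⟨w, hw, rfl⟩ := hv
    obtain ⟨p, q, rfl⟩ := mem_vectors_latticeAt.1 hw
    simp only [diagFlow_mulVec] at hv0 ⊢
    rw [norm_eq_max]
    simp only [Matrix.cons_val_zero, Matrix.cons_val_one, abs_mul, Real.abs_exp] at hv0 ⊢
    by_cases hq : q = 0
    · subst hq
      have hp : p ≠ 0 := by
        rintro rfl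
        apply hv0; ext i; fin_cases i <;> simp
      have h1 : (1 : ℝ) ≤ |(p : ℝ)| := by exact_mod_cast Int.one_le_abs hp
      have h2 : 1 ≤ Real.exp s := Real.one_le_exp hs
      refine (min_le_left _ _).trans (le_max_of_le_left ?_)
      simp only [Int.cast_zero, mul_zero, add_zero]
      nlinarith
    · refine (min_le_right _ _).trans ?_
      by_contra! hlt
      obtain ⟨h1, h2⟩ := max_lt_iff.1 hlt
      have h3 := mul_lt_mul'' h1 h2 (by positivity) (by positivity)
      rw [Real.mul_self_sqrt hc.le] at h3
      have h4 : Real.exp s * |p + α * q| * (Real.exp (-s) * |(q : ℝ)|)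
          = |(q : ℝ)| * |p + α * q| := by
        rw [Real.exp_neg]; field_simp
      have := hα p q hq
      linarith
  · rintro ⟨ε, hε, h⟩
    -- The flow time at which a vector with second coordinate `q` has been contracted to height
    -- `ε / 2`; replacing `ε` by `min ε 1` makes it nonnegative.
    set δ := min ε 1 with hδ
    have hδ0 : 0 < δ := by positivity
    refine mem_BA_of_le_mul_abs (c := δ ^ 2 / 2) (by positivity) fun p q hq => ?_
    have hq1 : (1 : ℝ) ≤ |(q : ℝ)| := by exact_mod_cast Int.one_le_abs hq
    have harg : 1 ≤ 2 * |(q : ℝ)| / δ := by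
      rw [le_div_iff₀ hδ0]; linarith [min_le_right ε 1]
    have hlong := h (Real.log (2 * |(q : ℝ)| / δ)) (Real.log_nonneg harg)
      _ (by rw [vectors_smul]; exact ⟨_, mem_vectors_latticeAt.2 ⟨p, q, rfl⟩, rfl⟩) (by
        intro h0
        simp only [diagFlow_mulVec] at h0
        have := congrFun h0 1
        simp [hq] at this)
    simp only [diagFlow_mulVec] at hlong
    rw [ norm_eq_max, Real.exp_neg, Real.exp_log (by linarith)] at hlong
    simp only [Matrix.cons_val_zero, Matrix.cons_val_one, abs_mul] at hlong
    have hδle : δ ≤ ε := min_le_left _ _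
    rcases le_max_iff.1 hlong with h1 | h1
    · rw [abs_of_pos (by linarith), div_mul_eq_mul_div, le_div_iff₀ hδ0] at h1
      nlinarith
    · exfalso
      rw [abs_inv, abs_of_pos (by linarith : 0 < 2 * |(q : ℝ)| / δ)] at h1
      have : (2 * |(q : ℝ)| / δ)⁻¹ * |(q : ℝ)| = δ / 2 := by
        field_simp
      linarith

/-! ### Reduction theory and Mahler's criterion -/

lemma unip_intCast_mem (n : ℤ) : unip n ∈ Γ := by
  refine ⟨⟨!![1, n; 0, 1], by simp [Matrix.det_fin_two]⟩, Subtype.ext ?_⟩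
  change (Int.castRingHom ℝ).mapMatrix !![1, n; 0, 1] = !![1, (n : ℝ); 0, 1]
  ext i j
  fin_cases i <;> fin_cases j <;> simp

lemma lowUnip_intCast_mem (n : ℤ) : lowUnip n ∈ Γ := by
  refine ⟨⟨!![1, 0; n, 1], by simp [Matrix.det_fin_two]⟩, Subtype.ext ?_⟩
  change (Int.castRingHom ℝ).mapMatrix !![1, 0; n, 1] = !![1, 0; (n : ℝ), 1]
  ext i j
  fin_cases i <;> fin_cases j <;> simp

lemma forall_vectors_mk {P : (Fin 2 → ℝ) → Prop} {g : G} :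
    (∀ v ∈ vectors (QuotientGroup.mk g : X), v ≠ 0 → P v) ↔ ∀ m : Fin 2 → ℤ, m ≠ 0 →
      P ((g : Matrix (Fin 2) (Fin 2) ℝ) *ᵥ fun i => (m i : ℝ)) := by
  constructor
  · intro h m hm
    refine h _ ⟨m, rfl⟩ fun h0 => hm ?_
    have h1 := congrArg (fun v => ((g⁻¹ : G) : Matrix (Fin 2) (Fin 2) ℝ) *ᵥ v) h0
    simp only [Matrix.mulVec_mulVec, ← Matrix.SpecialLinearGroup.coe_mul, inv_mul_cancel,
      Matrix.SpecialLinearGroup.coe_one, Matrix.one_mulVec, Matrix.mulVec_zero] at h1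
    ext i
    have h2 : (m i : ℝ) = 0 := congrFun h1 i
    exact_mod_cast h2
  · rintro h _ ⟨m, rfl⟩ h0
    refine h m ?_
    rintro rfl
    exact h0 (by ext i; fin_cases i <;> simp)

/-- A lattice without short vectors has a basis with bounded coordinates. A basis that almost
minimizes the sum of squared lengths is almost orthogonal, as neither vector can be shortened by
adding or subtracting the other; since it spans area `1`, its vectors are then not long. -/
lemma LongVectors.exists_rep_abs_le {ε : ℝ} (hε : 0 < ε) {Λ : X} (h : LongVectors ε Λ) :
    ∃ g : G, (QuotientGroup.mk g : X) = Λ ∧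
      ∀ i j, |(g : Matrix (Fin 2) (Fin 2) ℝ) i j| ≤ 2 / ε := by
  set F : G → ℝ := fun g => (g : Matrix (Fin 2) (Fin 2) ℝ) 0 0 ^ 2 +
    (g : Matrix (Fin 2) (Fin 2) ℝ) 1 0 ^ 2 + (g : Matrix (Fin 2) (Fin 2) ℝ) 0 1 ^ 2 +
    (g : Matrix (Fin 2) (Fin 2) ℝ) 1 1 ^ 2 with hF
  set S : Set ℝ := F '' {g | (QuotientGroup.mk g : X) = Λ} with hS
  have hbdd : BddBelow S := by
    refine ⟨0, ?_⟩
    rintro _ ⟨g, -, rfl⟩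
    simp only [hF]; positivity
  have hne : S.Nonempty := by
    obtain ⟨g, hg⟩ := QuotientGroup.mk_surjective Λ
    exact ⟨F g, g, hg, rfl⟩
  obtain ⟨_, ⟨k, hk, rfl⟩, hlt⟩ :=
    exists_lt_of_csInf_lt hne (lt_add_of_pos_right (sInf S) (by positivity : 0 < ε ^ 2 / 2))
  have hmin : ∀ δ ∈ Γ, F k - ε ^ 2 / 2 ≤ F (k * δ) := by
    intro δ hδ
    have : F (k * δ) ∈ S := by
      refine ⟨k * δ, ?_, rfl⟩
      rw [Set.mem_ofPred_eq, QuotientGroup.mk_mul_of_mem k hδ]; exact hk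
    linarith [csInf_le hbdd this]
  refine ⟨k, hk, ?_⟩
  rw [← (hk : QuotientGroup.mk k = Λ)] at h
  have hdet := k.det_coe
  rw [Matrix.det_fin_two] at hdet
  have h1 := hmin _ (unip_intCast_mem 1)
  have h2 := hmin _ (unip_intCast_mem (-1))
  have h3 := hmin _ (lowUnip_intCast_mem 1)
  have h4 := hmin _ (lowUnip_intCast_mem (-1))
  simp only [hF, Matrix.SpecialLinearGroup.coe_mul, coe_unip, coe_lowUnip, Matrix.mul_apply,
    Fin.sum_univ_two, Matrix.of_apply, Matrix.cons_val', Matrix.cons_val_zero,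
    Matrix.cons_val_one, Matrix.cons_val_fin_one, Int.cast_one, Int.cast_neg] at h1 h2 h3 h4
  have h5 := forall_vectors_mk.1 h ![1, 0] (by simp)
  have h6 := forall_vectors_mk.1 h ![0, 1] (by simp)
  rw [norm_eq_max, mulVec_apply_zero, mulVec_apply_one] at h5 h6
  simp only [Matrix.cons_val_zero, Matrix.cons_val_one, Int.cast_one, Int.cast_zero, mul_one,
    mul_zero, add_zero, zero_add] at h5 h6
  rw [Fin.forall_fin_two, Fin.forall_fin_two, Fin.forall_fin_two]
  generalize (k : Matrix (Fin 2) (Fin 2) ℝ) 0 0 = a at *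
  generalize (k : Matrix (Fin 2) (Fin 2) ℝ) 0 1 = b at *
  generalize (k : Matrix (Fin 2) (Fin 2) ℝ) 1 0 = c at *
  generalize (k : Matrix (Fin 2) (Fin 2) ℝ) 1 1 = d at *
  have sq : ∀ x y : ℝ, ε ≤ max |x| |y| → ε ^ 2 ≤ x ^ 2 + y ^ 2 := by
    intro x y hxy
    rcases le_max_iff.1 hxy with h | h
    · have := pow_le_pow_left₀ hε.le h 2
      rw [sq_abs] at this
      nlinarith [sq_nonneg y]
    · have := pow_le_pow_left₀ hε.le h 2
      rw [sq_abs] at this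
      nlinarith [sq_nonneg x]
  have hA := sq _ _ h5
  have hB := sq _ _ h6
  obtain ⟨A, hAdef⟩ : ∃ A, A = a ^ 2 + c ^ 2 := ⟨_, rfl⟩
  obtain ⟨B, hBdef⟩ : ∃ B, B = b ^ 2 + d ^ 2 := ⟨_, rfl⟩
  obtain ⟨p, hp⟩ : ∃ p, p = a * b + c * d := ⟨_, rfl⟩
  have hAB : A * B = p ^ 2 + 1 := by
    rw [hAdef, hBdef, hp]; linear_combination (a * d - b * c + 1) * hdet
  have hA0 : ε ^ 2 ≤ A := by rw [hAdef]; exact hA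
  have hB0 : ε ^ 2 ≤ B := by rw [hBdef]; exact hB
  have hpA : |2 * p| ≤ 3 / 2 * A := abs_le.2 ⟨by linarith, by linarith⟩
  have hpB : |2 * p| ≤ 3 / 2 * B := abs_le.2 ⟨by linarith, by linarith⟩
  have hε2 : 0 < ε ^ 2 := by positivity
  have hAB' : A * B ≤ 4 := by
    have := mul_le_mul hpA hpB (abs_nonneg _) (by linarith)
    rw [abs_mul_abs_self] at this
    linarith
  have hA4 : ε ^ 2 * A ≤ 4 := by
    linarith [mul_le_mul_of_nonneg_right hB0 (hε2.le.trans hA0)]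
  have hB4 : ε ^ 2 * B ≤ 4 := by
    linarith [mul_le_mul_of_nonneg_right hA0 (hε2.le.trans hB0)]
  clear h1 h2 h3 h4 h5 h6 hA hB
  rw [hAdef] at hA4
  rw [hBdef] at hB4
  have fin : ∀ x : ℝ, ε ^ 2 * x ^ 2 ≤ 4 → |x| ≤ 2 / ε := by
    intro x hx
    rw [le_div_iff₀ hε]
    refine (abs_le_of_sq_le_sq' ?_ (by norm_num)).2
    rw [mul_pow, sq_abs]; linarith
  have ha := fin a (by linarith [mul_nonneg hε2.le (sq_nonneg c)])
  have hc := fin c (by linarith [mul_nonneg hε2.le (sq_nonneg a)])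
  have hb := fin b (by linarith [mul_nonneg hε2.le (sq_nonneg d)])
  have hd := fin d (by linarith [mul_nonneg hε2.le (sq_nonneg b)])
  exact ⟨⟨ha, hb⟩, hc, hd⟩

lemma isCompact_setOf_abs_le (C : ℝ) :
    IsCompact {g : G | ∀ i j, |(g : Matrix (Fin 2) (Fin 2) ℝ) i j| ≤ C} := by
  have h1 : IsCompact (Set.univ.pi fun _ : Fin 2 => Set.univ.pi fun _ : Fin 2 =>
      Set.Icc (-C) C) :=
    isCompact_univ_pi fun _ => isCompact_univ_pi fun _ => isCompact_Icc
  have h2 := (Matrix.SpecialLinearGroup.isClosedEmbedding_val (n := Fin 2)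
    (R := ℝ)).isCompact_preimage h1
  refine h2.of_isClosed_subset ?_ fun g hg => ?_
  · simp only [Set.ofPred_forall]
    exact isClosed_iInter fun i => isClosed_iInter fun j =>
      isClosed_le (by fun_prop) continuous_const
  · exact fun i _ j _ => abs_le.1 (hg i j)

lemma continuous_mulVec (v : Fin 2 → ℝ) :
    Continuous fun g : G => (g : Matrix (Fin 2) (Fin 2) ℝ) *ᵥ v := by
  refine continuous_pi fun i => ?_
  simp only [Matrix.mulVec, dotProduct, Fin.sum_univ_two]
  fun_prop

lemma isClosed_setOf_forall_vectors_le {N : (Fin 2 → ℝ) → ℝ} (hN : Continuous N) (r : ℝ) :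
    IsClosed {Λ : X | ∀ v ∈ vectors Λ, v ≠ 0 → r ≤ N v} := by
  rw [← (QuotientGroup.isQuotientMap_mk (N := Γ)).isClosed_preimage]
  have : (QuotientGroup.mk : G → X) ⁻¹' {Λ : X | ∀ v ∈ vectors Λ, v ≠ 0 → r ≤ N v} =
      ⋂ (m : Fin 2 → ℤ) (_ : m ≠ 0),
        {g : G | r ≤ N ((g : Matrix (Fin 2) (Fin 2) ℝ) *ᵥ fun i => (m i : ℝ))} := by
    ext g
    simp only [Set.mem_preimage, Set.mem_ofPred_eq, forall_vectors_mk, Set.mem_iInter]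
  rw [this]
  exact isClosed_iInter fun m => isClosed_iInter fun _ =>
    isClosed_le continuous_const (hN.comp (continuous_mulVec _))

lemma isClosed_setOf_longVectors (ε : ℝ) : IsClosed {Λ : X | LongVectors ε Λ} :=
  isClosed_setOf_forall_vectors_le continuous_norm ε

/-- Mahler's compactness criterion. -/
lemma isCompact_setOf_longVectors {ε : ℝ} (hε : 0 < ε) : IsCompact {Λ : X | LongVectors ε Λ} := by
  refine ((isCompact_setOf_abs_le (2 / ε)).image
    (QuotientGroup.continuous_mk (N := Γ))).of_isClosed_subset (isClosed_setOf_longVectors ε) ?_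
  intro Λ hΛ
  obtain ⟨g, hg, hb⟩ := LongVectors.exists_rep_abs_le hε hΛ
  exact ⟨g, hb, hg⟩

lemma norm_mulVec_le {A : Matrix (Fin 2) (Fin 2) ℝ} {C : ℝ} (h : ∀ i j, |A i j| ≤ C)
    (v : Fin 2 → ℝ) : ‖A *ᵥ v‖ ≤ 2 * C * ‖v‖ := by
  have hC : 0 ≤ C := (abs_nonneg _).trans (h 0 0)
  have key : ∀ i j, |A i j * v j| ≤ C * ‖v‖ := fun i j => by
    rw [abs_mul]
    exact mul_le_mul (h i j) (norm_le_pi_norm v j) (abs_nonneg _) hC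
  rw [norm_eq_max, mulVec_apply_zero, mulVec_apply_one]
  refine max_le ((abs_add_le _ _).trans ?_) ((abs_add_le _ _).trans ?_)
  · linarith [key 0 0, key 0 1]
  · linarith [key 1 0, key 1 1]

lemma LongVectors.smul_of_abs_inv_le {ε C : ℝ} {Λ : X} {g : G} (h : LongVectors ε Λ) (hC : 0 < C)
    (hg : ∀ i j, |((g⁻¹ : G) : Matrix (Fin 2) (Fin 2) ℝ) i j| ≤ C) :
    LongVectors (ε / (2 * C)) (g • Λ) := by
  refine h.smul (by positivity) fun v => ?_
  have h1 := norm_mulVec_le hg ((g : Matrix (Fin 2) (Fin 2) ℝ) *ᵥ v)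
  rwa [Matrix.mulVec_mulVec, ← Matrix.SpecialLinearGroup.coe_mul, inv_mul_cancel,
    Matrix.SpecialLinearGroup.coe_one, Matrix.one_mulVec] at h1

lemma longVectors_unip_smul_latticeAt_zero (x : ℝ) : LongVectors 1 (unip x • latticeAt 0) := by
  rw [unip_smul_latticeAt]
  intro v hv h0
  obtain ⟨p, q, rfl⟩ := mem_vectors_latticeAt.1 hv
  rw [norm_eq_max]
  simp only [Matrix.cons_val_zero, Matrix.cons_val_one]
  by_cases hq : q = 0
  · subst hq
    have hp : p ≠ 0 := by
      rintro rfl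
      apply h0; ext i; fin_cases i <;> simp
    refine le_max_of_le_left ?_
    simpa using (by exact_mod_cast Int.one_le_abs hp : (1 : ℝ) ≤ |(p : ℝ)|)
  · exact le_max_of_le_right (by exact_mod_cast Int.one_le_abs hq)

lemma exists_longVectors (Λ : X) : ∃ ε : ℝ, 0 < ε ∧ LongVectors ε Λ := by
  obtain ⟨g, rfl⟩ := QuotientGroup.mk_surjective Λ
  obtain ⟨C, hC⟩ : ∃ C : ℝ, ∀ i j, |((g⁻¹ : G) : Matrix (Fin 2) (Fin 2) ℝ) i j| ≤ C := by
    obtain ⟨C, hC⟩ := Finite.bddAbove_range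
      (fun ij : Fin 2 × Fin 2 => |((g⁻¹ : G) : Matrix (Fin 2) (Fin 2) ℝ) ij.1 ij.2|)
    exact ⟨C, fun i j => hC ⟨(i, j), rfl⟩⟩
  have h1 := longVectors_unip_smul_latticeAt_zero 0
  have h2 := h1.smul_of_abs_inv_le (g := g) (C := max C 1) (by positivity)
    fun i j => (hC i j).trans (le_max_left _ _)
  refine ⟨1 / (2 * max C 1), by positivity, ?_⟩
  convert h2 using 1
  rw [unip_zero, one_smul]
  change _ = QuotientGroup.mk (g * unip 0)
  rw [unip_zero, mul_one]

lemma HasPrecompactOrbit.exists_longVectors {Λ : X} (h : HasPrecompactOrbit Λ) :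
    ∃ ε : ℝ, 0 < ε ∧ ∀ t : ℝ, LongVectors ε (diagFlow t • Λ) := by
  suffices H : ∃ ε : ℝ, 0 < ε ∧
      ∀ Λ' ∈ closure (Set.range fun t : ℝ => diagFlow t • Λ), LongVectors ε Λ' by
    obtain ⟨ε, hε, H⟩ := H
    exact ⟨ε, hε, fun t => H _ (subset_closure ⟨t, rfl⟩)⟩
  refine IsCompact.induction_on (p := fun s => ∃ ε : ℝ, 0 < ε ∧ ∀ Λ' ∈ s, LongVectors ε Λ') h
    ⟨1, one_pos, by simp⟩ ?_ ?_ ?_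
  · rintro s t hst ⟨ε, hε, H⟩
    exact ⟨ε, hε, fun Λ' hΛ' => H _ (hst hΛ')⟩
  · rintro s t ⟨ε, hε, H⟩ ⟨ε', hε', H'⟩
    refine ⟨min ε ε', lt_min hε hε', ?_⟩
    rintro Λ' (hΛ' | hΛ')
    · exact (H _ hΛ').mono (min_le_left _ _)
    · exact (H' _ hΛ').mono (min_le_right _ _)
  · intro Λ' _
    obtain ⟨ε, hε, hΛ'⟩ := NormDirichlet.exists_longVectors Λ'
    obtain ⟨g, rfl⟩ := QuotientGroup.mk_surjective Λ'
    set W : Set G := {h | ∀ i j, |((g * h⁻¹ : G) : Matrix (Fin 2) (Fin 2) ℝ) i j| < 2} with hW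
    have hWo : IsOpen W := by
      simp only [hW, Set.ofPred_forall]
      refine isOpen_iInter_of_finite fun i => isOpen_iInter_of_finite fun j => ?_
      exact isOpen_lt (by fun_prop) continuous_const
    have hgW : g ∈ W := by
      intro i j
      rw [mul_inv_cancel, Matrix.SpecialLinearGroup.coe_one, Matrix.one_apply]
      split_ifs <;> simp
    refine ⟨(QuotientGroup.mk : G → X) '' W, mem_nhdsWithin_of_mem_nhds
      ((QuotientGroup.isOpenMap_coe W hWo).mem_nhds ⟨g, hgW, rfl⟩), ε / (2 * 2), by positivity, ?_⟩
    rintro _ ⟨k, hk, rfl⟩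
    have h1 := hΛ'.smul_of_abs_inv_le (g := k * g⁻¹) (C := 2) (by norm_num) (by
      intro i j
      rw [mul_inv_rev, inv_inv]
      exact (hk i j).le)
    convert h1 using 1
    change _ = QuotientGroup.mk (k * g⁻¹ * g)
    rw [inv_mul_cancel_right]

lemma hasPrecompactOrbit_of_longVectors {ε : ℝ} (hε : 0 < ε) {Λ : X}
    (h : ∀ t : ℝ, LongVectors ε (diagFlow t • Λ)) : HasPrecompactOrbit Λ := by
  refine (isCompact_setOf_longVectors hε).of_isClosed_subset isClosed_closure
    (closure_minimal ?_ (isClosed_setOf_longVectors ε))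
  rintro _ ⟨t, rfl⟩
  exact h t

/-! ### Dirichlet improvability in terms of the flow -/

lemma exists_seminorm_le_mul_norm (ν : Seminorm ℝ (Fin 2 → ℝ)) :
    ∃ K : ℝ, 0 < K ∧ ∀ v, ν v ≤ K * ‖v‖ := by
  refine ⟨ν (Pi.single 0 1) + ν (Pi.single 1 1) + 1, by positivity, fun v => ?_⟩
  have hv : v = v 0 • Pi.single 0 1 + v 1 • Pi.single 1 1 := by
    ext i; fin_cases i <;> simp
  have h0 : |v 0| ≤ ‖v‖ := norm_le_pi_norm v 0
  have h1 : |v 1| ≤ ‖v‖ := norm_le_pi_norm v 1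
  calc ν v = ν (v 0 • Pi.single 0 1 + v 1 • Pi.single 1 1) := by rw [← hv]
    _ ≤ ν (v 0 • Pi.single 0 1) + ν (v 1 • Pi.single 1 1) := map_add_le_add _ _ _
    _ = |v 0| * ν (Pi.single 0 1) + |v 1| * ν (Pi.single 1 1) := by
      rw [map_smul_eq_mul, map_smul_eq_mul, Real.norm_eq_abs, Real.norm_eq_abs]
    _ ≤ ‖v‖ * ν (Pi.single 0 1) + ‖v‖ * ν (Pi.single 1 1) := by gcongr
    _ ≤ _ := by nlinarith [norm_nonneg v]

lemma continuous_seminorm (ν : Seminorm ℝ (Fin 2 → ℝ)) : Continuous ν := by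
  obtain ⟨K, hK, h⟩ := exists_seminorm_le_mul_norm ν
  refine LipschitzWith.continuous (K := ⟨K, hK.le⟩) (LipschitzWith.of_dist_le_mul fun v w => ?_)
  rw [Real.dist_eq, dist_eq_norm]
  exact (abs_sub_map_le_sub ν v w).trans (h _)

lemma exists_norm_le_mul_seminorm {ν : Seminorm ℝ (Fin 2 → ℝ)} (hν : ∀ v, ν v = 0 → v = 0) :
    ∃ K : ℝ, 0 < K ∧ ∀ v, ‖v‖ ≤ K * ν v := by
  obtain ⟨x, hx, hmin⟩ := (isCompact_sphere (0 : Fin 2 → ℝ) 1).exists_isMinOn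
    (NormedSpace.sphere_nonempty.2 zero_le_one) (continuous_seminorm ν).continuousOn
  have hx0 : 0 < ν x := by
    refine lt_of_le_of_ne (apply_nonneg ν x) fun h => ?_
    rw [hν x h.symm] at hx
    simp at hx
  refine ⟨(ν x)⁻¹, inv_pos.2 hx0, fun v => ?_⟩
  rw [inv_mul_eq_div, le_div_iff₀ hx0]
  by_cases hv : v = 0
  · simp [hv]
  have hv' : 0 < ‖v‖ := norm_pos_iff.2 hv
  have h1 : ν x ≤ ν (‖v‖⁻¹ • v) := hmin (by simp [norm_smul, hv'.ne'])
  rw [map_smul_eq_mul, norm_inv, norm_norm, inv_mul_eq_div, le_div_iff₀ hv'] at h1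
  linarith

lemma vectors_inter_ball_eq_iff {ν : Seminorm ℝ (Fin 2 → ℝ)} {Λ : X} {r : ℝ} :
    vectors Λ ∩ ν.ball 0 r = {0} ↔ 0 < r ∧ ∀ v ∈ vectors Λ, v ≠ 0 → r ≤ ν v := by
  constructor
  · intro h
    have h0 : (0 : Fin 2 → ℝ) ∈ vectors Λ ∩ ν.ball 0 r := by rw [h]; rfl
    refine ⟨by simpa [Seminorm.mem_ball] using h0.2, fun v hv hv0 => ?_⟩
    by_contra! hlt
    have : v ∈ vectors Λ ∩ ν.ball 0 r := ⟨hv, by simpa [Seminorm.mem_ball] using hlt⟩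
    rw [h] at this
    exact hv0 this
  · rintro ⟨hr, h⟩
    ext v
    simp only [Set.mem_inter_iff, Seminorm.mem_ball, sub_zero, Set.mem_singleton_iff]
    constructor
    · rintro ⟨hv, hlt⟩
      by_contra hv0
      linarith [h v hv hv0]
    · rintro rfl
      exact ⟨zero_mem_vectors Λ, by simpa using hr⟩

lemma forall_vectors_smul {P : (Fin 2 → ℝ) → Prop} {g : G} {Λ : X} :
    (∀ v ∈ vectors (g • Λ), v ≠ 0 → P v) ↔ ∀ v ∈ vectors Λ, v ≠ 0 →
      P ((g : Matrix (Fin 2) (Fin 2) ℝ) *ᵥ v) := by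
  rw [vectors_smul]
  constructor
  · intro h v hv hv0
    refine h _ ⟨v, hv, rfl⟩ fun h0 => hv0 ?_
    have h1 := congrArg (fun v => ((g⁻¹ : G) : Matrix (Fin 2) (Fin 2) ℝ) *ᵥ v) h0
    simpa only [Matrix.mulVec_mulVec, ← Matrix.SpecialLinearGroup.coe_mul, inv_mul_cancel,
      Matrix.SpecialLinearGroup.coe_one, Matrix.one_mulVec, Matrix.mulVec_zero] using h1
  · rintro h _ ⟨v, hv, rfl⟩ h0
    exact h v hv fun hv0 => h0 (by simp [hv0])

/-- Multiplying by `g_s` with `e^s = T / c` turns the box `diag(c²T⁻¹, T) B_ν(r)` into the ball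
`B_ν(c r)`. -/
lemma vectors_latticeAt_inter_eq_iff {ν : Seminorm ℝ (Fin 2 → ℝ)} {α r c s T : ℝ} (hc : 0 < c)
    (hT : T = c * Real.exp s) :
    vectors (latticeAt α) ∩ (fun v : Fin 2 → ℝ => !![c ^ 2 * T⁻¹, 0; 0, T] *ᵥ v) '' ν.ball 0 r = {0}
      ↔ 0 < r ∧ ∀ v ∈ vectors (diagFlow s • latticeAt α), v ≠ 0 → c * r ≤ ν v := by
  have hD : ∀ w, (diagFlow s : Matrix (Fin 2) (Fin 2) ℝ) *ᵥ (!![c ^ 2 * T⁻¹, 0; 0, T] *ᵥ w)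
      = c • w := by
    intro w
    have he := Real.exp_pos s
    rw [diagFlow_mulVec]
    ext i
    fin_cases i
    · simp [mulVec_apply_zero, hT]; field_simp
    · simp [mulVec_apply_one, hT, Real.exp_neg]; field_simp
  have hD' : ∀ u, !![c ^ 2 * T⁻¹, 0; 0, T] *ᵥ
      (c⁻¹ • ((diagFlow s : Matrix (Fin 2) (Fin 2) ℝ) *ᵥ u)) = u := by
    intro u
    have he := Real.exp_pos s
    rw [diagFlow_mulVec]
    ext i
    fin_cases i
    · simp [mulVec_apply_zero, hT]; field_simp
    · simp [mulVec_apply_one, hT, Real.exp_neg]; field_simp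
  rw [forall_vectors_smul]
  constructor
  · intro h
    have h0 : (0 : Fin 2 → ℝ) ∈ vectors (latticeAt α) ∩
      (fun v : Fin 2 → ℝ => !![c ^ 2 * T⁻¹, 0; 0, T] *ᵥ v) '' ν.ball 0 r := by rw [h]; rfl
    obtain ⟨-, w, hw, -⟩ := h0
    rw [Seminorm.mem_ball, sub_zero] at hw
    refine ⟨(apply_nonneg ν w).trans_lt hw, fun u hu hu0 => ?_⟩
    by_contra! hlt
    refine hu0 ?_
    have : u ∈ vectors (latticeAt α) ∩
      (fun v : Fin 2 → ℝ => !![c ^ 2 * T⁻¹, 0; 0, T] *ᵥ v) '' ν.ball 0 r := by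
      refine ⟨hu, _, ?_, hD' u⟩
      rw [Seminorm.mem_ball, sub_zero, map_smul_eq_mul, norm_inv, Real.norm_eq_abs, abs_of_pos hc,
        inv_mul_eq_div, div_lt_iff₀ hc]
      linarith
    rwa [h] at this
  · rintro ⟨hr, h⟩
    ext u
    simp only [Set.mem_inter_iff, Set.mem_singleton_iff]
    constructor
    · rintro ⟨hu, w, hw, rfl⟩
      by_contra hu0
      have h1 := h _ hu hu0
      simp only [hD] at h1
      rw [Seminorm.mem_ball, sub_zero] at hw
      rw [map_smul_eq_mul, Real.norm_eq_abs, abs_of_pos hc] at h1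
      linarith [le_of_mul_le_mul_left h1 hc]
    · rintro rfl
      exact ⟨zero_mem_vectors _, 0, by simpa [Seminorm.mem_ball] using hr, by simp⟩

/-- `α` fails to be `ν`-Dirichlet improvable exactly when the forward orbit of `Λ_α` comes
arbitrarily close to the critical locus at arbitrarily large times. -/
lemma not_mem_DI_iff {ν : Seminorm ℝ (Fin 2 → ℝ)} {α : ℝ} :
    α ∉ DI ν ↔ 0 < criticalRadius ν ∧ ∀ c : ℝ, 0 < c → c < 1 → ∀ s₀ : ℝ, ∃ s : ℝ, s₀ ≤ s ∧
      ∀ v ∈ vectors (diagFlow s • latticeAt α), v ≠ 0 → c * criticalRadius ν ≤ ν v := by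
  constructor
  · intro h
    have key : ∀ c : ℝ, 0 < c → c < 1 → ∀ s₀ : ℝ, ∃ s : ℝ, s₀ ≤ s ∧ 0 < criticalRadius ν ∧
        ∀ v ∈ vectors (diagFlow s • latticeAt α), v ≠ 0 → c * criticalRadius ν ≤ ν v := by
      intro c hc hc1 s₀
      by_contra! hcon
      refine h ⟨c ^ 2, by positivity, by nlinarith, c * Real.exp s₀, by positivity,
        fun T hT heq => ?_⟩
      have hTc : Real.exp s₀ ≤ T / c := by rw [le_div_iff₀ hc]; linarith
      have hTc0 : 0 < T / c := (Real.exp_pos _).trans_le hTc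
      rw [vectors_latticeAt_inter_eq_iff (s := Real.log (T / c)) hc (by
        rw [Real.exp_log hTc0]; field_simp)] at heq
      obtain ⟨v, hv, hv0, hlt⟩ := hcon _ ((Real.le_log_iff_exp_le hTc0).2 hTc) heq.1
      linarith [heq.2 v hv hv0]
    refine ⟨?_, fun c hc hc1 s₀ => ?_⟩
    · obtain ⟨s, -, h1, -⟩ := key (1 / 2) (by norm_num) (by norm_num) 0
      exact h1
    · obtain ⟨s, h1, -, h2⟩ := key c hc hc1 s₀
      exact ⟨s, h1, h2⟩
  · rintro ⟨hr, h⟩ ⟨c, hc, hc1, T₀, hT₀, hT⟩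
    have hc' : 0 < √c := Real.sqrt_pos.2 hc
    obtain ⟨s, hs, hv⟩ := h √c hc' ((Real.sqrt_lt' one_pos).2 (by simpa using hc1))
      (Real.log (T₀ / √c))
    have hle : T₀ ≤ √c * Real.exp s := by
      have := (Real.log_le_iff_le_exp (by positivity)).1 hs
      rw [div_le_iff₀ hc'] at this
      linarith
    have h1 := hT _ hle
    rw [← Real.sq_sqrt hc.le] at h1
    refine h1 ?_
    rw [Real.sq_sqrt hc.le]
    have h2 := (vectors_latticeAt_inter_eq_iff (ν := ν) (α := α) (r := criticalRadius ν)
      (s := s) hc' rfl).2 ⟨hr, hv⟩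
    rwa [Real.sq_sqrt hc.le] at h2

/-- A limit point of the forward orbit along the times at which it approaches the critical locus
is a critical lattice, whose whole orbit consists of limit points of a bounded orbit. -/
lemma exists_criticalLocus_of_mem_BA_diff_DI {ν : Seminorm ℝ (Fin 2 → ℝ)} {α : ℝ} (hBA : α ∈ BA)
    (hDI : α ∉ DI ν) : ∃ Λ ∈ criticalLocus ν, HasPrecompactOrbit Λ := by
  obtain ⟨ε, hε, hα⟩ := mem_BA_iff.1 hBA
  obtain ⟨hr, h⟩ := not_mem_DI_iff.1 hDI
  set c : ℕ → ℝ := fun n => 1 - 1 / (n + 2) with hc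
  have hc0 : ∀ n, 0 < c n := fun n => by
    simp only [hc, sub_pos]
    rw [div_lt_one (by positivity)]
    linarith [(Nat.cast_nonneg n : (0 : ℝ) ≤ n)]
  have hc1 : ∀ n, c n < 1 := fun n => by
    simp only [hc]
    linarith [(by positivity : (0 : ℝ) < 1 / (n + 2))]
  have hcm : Monotone c := fun m n hmn => by
    simp only [hc]
    have : (1 : ℝ) / (n + 2) ≤ 1 / (m + 2) := by gcongr
    linarith
  -- The closures of the pieces of orbit after time `n` that are `c n`-close to critical.
  set O : ℕ → Set X := fun n => {Λ | ∃ s : ℝ, (n : ℝ) ≤ s ∧ diagFlow s • latticeAt α = Λ ∧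
    ∀ v ∈ vectors Λ, v ≠ 0 → c n * criticalRadius ν ≤ ν v} with hO
  have hOanti : ∀ n, O (n + 1) ⊆ O n := by
    rintro n Λ ⟨s, hs, hΛ, hv⟩
    refine ⟨s, by push_cast at hs; linarith, hΛ, fun v hv1 hv0 => ?_⟩
    exact (mul_le_mul_of_nonneg_right (hcm n.le_succ) hr.le).trans (hv v hv1 hv0)
  have hOne : ∀ n, (O n).Nonempty := fun n => by
    obtain ⟨s, hs, hv⟩ := h (c n) (hc0 n) (hc1 n) n
    exact ⟨_, s, hs, rfl, hv⟩
  have hOK : closure (O 0) ⊆ {Λ | LongVectors ε Λ} := by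
    refine closure_minimal ?_ (isClosed_setOf_longVectors ε)
    rintro Λ ⟨s, hs, rfl, -⟩
    exact hα s (by simpa using hs)
  obtain ⟨Λ, hΛ⟩ := IsCompact.nonempty_iInter_of_sequence_nonempty_isCompact_isClosed
    (fun n => closure (O n)) (fun n => closure_mono (hOanti n)) (fun n => (hOne n).closure)
    ((isCompact_setOf_longVectors hε).of_isClosed_subset isClosed_closure hOK)
    (fun n => isClosed_closure)
  rw [Set.mem_iInter] at hΛ
  refine ⟨Λ, ?_, hasPrecompactOrbit_of_longVectors hε fun t => ?_⟩
  · refine vectors_inter_ball_eq_iff.2 ⟨hr, fun v hv hv0 => ?_⟩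
    have h1 : ∀ n, c n * criticalRadius ν ≤ ν v := fun n =>
      closure_minimal (fun Λ' (hΛ' : Λ' ∈ O n) => hΛ'.choose_spec.2.2)
        (isClosed_setOf_forall_vectors_le (continuous_seminorm ν) _) (hΛ n) v hv hv0
    have h2 : Filter.Tendsto (fun n => c n * criticalRadius ν) Filter.atTop
        (nhds ((1 - 0) * criticalRadius ν)) := by
      refine Filter.Tendsto.mul_const _ (tendsto_const_nhds.sub ?_)
      have := (tendsto_one_div_add_atTop_nhds_zero_nat (𝕜 := ℝ)).comp (Filter.tendsto_add_atTop_nat 1)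
      refine this.congr fun n => ?_
      simp only [Function.comp_apply]; push_cast; ring_nf
    have h3 := le_of_tendsto' h2 h1
    linarith
  · obtain ⟨n, hn⟩ := exists_nat_ge (-t)
    have hcl : IsClosed {Λ' : X | LongVectors ε (diagFlow t • Λ')} :=
      (isClosed_setOf_longVectors ε).preimage (continuous_const_smul (diagFlow t))
    refine closure_minimal ?_ hcl (hΛ n)
    rintro _ ⟨s, hs, rfl, -⟩
    rw [Set.mem_ofPred_eq, smul_smul, diagFlow_mul_diagFlow]
    exact hα _ (by linarith)

/-! ### Connecting two lattices by the flow -/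

lemma exists_nat_forall_quadratic_pos (A B : ℝ) {D : ℝ} (hD : 0 < D) :
    ∃ N : ℕ, ∀ n : ℕ, N ≤ n → 0 < A + B * n + D * n ^ 2 := by
  obtain ⟨N, hN⟩ := exists_nat_gt ((|A| + |B|) / D)
  refine ⟨N + 1, fun n hn => ?_⟩
  have hn' : (N : ℝ) + 1 ≤ n := by exact_mod_cast hn
  have h1 : (1 : ℝ) ≤ n := by linarith [(Nat.cast_nonneg N : (0 : ℝ) ≤ N)]
  rw [div_lt_iff₀ hD] at hN
  have h2 : (|A| + |B|) < n * D := by nlinarith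
  have h3 : (|A| + |B|) * n < n * D * n := by gcongr
  have h4 : |A| ≤ |A| * n := le_mul_of_one_le_right (abs_nonneg A) h1
  have h5 : -|B| * n ≤ B * n := by gcongr; exact neg_abs_le B
  have h6 := neg_abs_le A
  nlinarith

/-- Integer vectors are dense among directions: one of them is mapped by a unimodular matrix into
the sector `0 < -p₀ < p₁ / 2` (up to sign) while avoiding the direction of `w`. -/
lemma exists_int_vec_mem_sector {a b c d w₀ w₁ : ℝ} (hdet : a * d - b * c = 1)
    (hw : w₀ ≠ 0 ∨ w₁ ≠ 0) :
    ∃ m n : ℤ, (a * m + b * n) * (c * m + d * n) < 0 ∧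
      0 < (c * m + d * n) ^ 2 + 2 * ((a * m + b * n) * (c * m + d * n)) ∧ m * w₁ - n * w₀ ≠ 0 := by
  set U : Set (ℝ × ℝ) := {p | (a * p.1 + b * p.2) * (c * p.1 + d * p.2) < 0} ∩
    ({p | 0 < (c * p.1 + d * p.2) ^ 2 + 2 * ((a * p.1 + b * p.2) * (c * p.1 + d * p.2))} ∩
      {p | p.1 * w₁ - p.2 * w₀ ≠ 0}) with hU
  have hUo : IsOpen U := by
    refine IsOpen.inter (isOpen_lt (by fun_prop) (by fun_prop))
      (IsOpen.inter (isOpen_lt (by fun_prop) (by fun_prop)) (isOpen_ne_fun (by fun_prop)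
        (by fun_prop)))
  have hUne : U.Nonempty := by
    -- The preimages of `(-1, 3)` and `(-1, 4)` are not both parallel to `w`.
    have hp : ∀ k : ℝ, 2 < k → (-d - b * k) * w₁ - (c + a * k) * w₀ ≠ 0 → U.Nonempty := by
      intro k hk hne
      have h1 : a * (-d - b * k) + b * (c + a * k) = -1 := by linear_combination -hdet
      have h2 : c * (-d - b * k) + d * (c + a * k) = k := by linear_combination k * hdet
      refine ⟨(-d - b * k, c + a * k), ?_, ?_, hne⟩
      · simp only [Set.mem_ofPred_eq, h1, h2]; linarith
      · simp only [Set.mem_ofPred_eq, h1, h2]; nlinarith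
    by_contra hcon
    have h3 : (-d - b * 3) * w₁ - (c + a * 3) * w₀ = 0 := by
      by_contra h; exact hcon (hp 3 (by norm_num) h)
    have h4 : (-d - b * 4) * w₁ - (c + a * 4) * w₀ = 0 := by
      by_contra h; exact hcon (hp 4 (by norm_num) h)
    have h5 : a * w₀ + b * w₁ = 0 := by linarith
    have h6 : c * w₀ + d * w₁ = 0 := by linarith
    have h7 : w₀ = 0 := by linear_combination d * h5 - b * h6 - w₀ * hdet
    have h8 : w₁ = 0 := by linear_combination a * h6 - c * h5 - w₁ * hdet
    exact hw.elim (fun h => h h7) (fun h => h h8)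
  obtain ⟨⟨q₀, q₁⟩, hq⟩ := (Rat.denseRange_cast.prodMap Rat.denseRange_cast).exists_mem_open hUo hUne
  obtain ⟨h1, h2, h3⟩ := hq
  simp only [Prod.map_fst, Prod.map_snd, Set.mem_ofPred_eq] at h1 h2 h3
  have hd₀ : (0 : ℝ) < q₀.den := by exact_mod_cast q₀.den_pos
  have hd₁ : (0 : ℝ) < q₁.den := by exact_mod_cast q₁.den_pos
  have hn₀ : (q₀.num : ℝ) = q₀ * q₀.den := by exact_mod_cast (Rat.mul_den_eq_num q₀).symm
  have hn₁ : (q₁.num : ℝ) = q₁ * q₁.den := by exact_mod_cast (Rat.mul_den_eq_num q₁).symm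
  have hD : (0 : ℝ) < q₀.den * q₁.den := by positivity
  refine ⟨q₀.num * q₁.den, q₁.num * q₀.den, ?_, ?_, ?_⟩
  · push_cast
    rw [hn₀, hn₁]
    nlinarith [mul_pos_of_neg_of_neg h1 (by nlinarith : -(q₀.den * q₁.den : ℝ) ^ 2 < 0)]
  · push_cast
    rw [hn₀, hn₁]
    nlinarith [mul_pos h2 (by positivity : (0 : ℝ) < (q₀.den * q₁.den : ℝ) ^ 2)]
  · push_cast
    rw [hn₀, hn₁]
    have : (q₀ * q₀.den * q₁.den * w₁ - q₁ * q₁.den * q₀.den * w₀ : ℝ) =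
      (q₀.den * q₁.den) * (q₀ * w₁ - q₁ * w₀) := by ring
    rw [this]
    exact mul_ne_zero hD.ne' h3

lemma sector_of_quadratic {x y : ℝ} (h₁ : x * y < 0) (h₂ : 0 < y ^ 2 + 2 * (x * y)) (hy : 0 < y) :
    x < 0 ∧ 0 < y + 2 * x := by
  refine ⟨?_, ?_⟩
  · by_contra! h
    linarith [mul_nonneg h hy.le]
  · by_contra! h
    linarith [mul_nonneg hy.le (neg_nonneg.2 h)]

/-- The orbit of a direction under `SL₂(ℤ)` is dense: a high power of the parabolic element fixing
an integer vector turns every other direction close to that vector. -/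
lemma exists_mem_Γ_mul_inv_mem_sector (h k : G) :
    ∃ γ ∈ Γ, 0 < ((h * γ * k⁻¹ : G) : Matrix (Fin 2) (Fin 2) ℝ) 1 1 ∧
      ((h * γ * k⁻¹ : G) : Matrix (Fin 2) (Fin 2) ℝ) 0 1 < 0 ∧
      0 < ((h * γ * k⁻¹ : G) : Matrix (Fin 2) (Fin 2) ℝ) 1 1 +
        2 * ((h * γ * k⁻¹ : G) : Matrix (Fin 2) (Fin 2) ℝ) 0 1 := by
  have hh := h.det_coe
  have hk := (k⁻¹).det_coe
  rw [Matrix.det_fin_two] at hh hk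
  obtain ⟨m, n, h1, h2, h3⟩ := exists_int_vec_mem_sector hh
    (w₀ := ((k⁻¹ : G) : Matrix (Fin 2) (Fin 2) ℝ) 0 1)
    (w₁ := ((k⁻¹ : G) : Matrix (Fin 2) (Fin 2) ℝ) 1 1) (by
      by_contra! hcon
      rw [hcon.1, hcon.2] at hk
      simp at hk)
  have hγ : ∀ N : ℕ, (!![1 - N * (m * n), N * m ^ 2; -(N * n ^ 2), 1 + N * (m * n)] :
      Matrix (Fin 2) (Fin 2) ℤ).det = 1 := by
    intro N
    rw [Matrix.det_fin_two]
    simp only [Matrix.of_apply, Matrix.cons_val', Matrix.cons_val_zero, Matrix.cons_val_one,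
      Matrix.cons_val_fin_one]
    ring
  set γ : ℕ → G := fun N => Matrix.SpecialLinearGroup.map (Int.castRingHom ℝ) ⟨_, hγ N⟩ with hγdef
  have hγΓ : ∀ N, γ N ∈ Γ := fun N => ⟨_, rfl⟩
  have hγ0 : ∀ N, (γ N : Matrix (Fin 2) (Fin 2) ℝ) =
      (!![1 - N * (m * n), N * m ^ 2; -(N * n ^ 2), 1 + N * (m * n)] : Matrix _ _ ℝ) := by
    intro N
    change (Int.castRingHom ℝ).mapMatrix
      (!![1 - N * (m * n), N * m ^ 2; -(N * n ^ 2), 1 + N * (m * n)] : Matrix _ _ ℤ) = _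
    ext i j
    fin_cases i <;> fin_cases j <;> simp
  generalize hw₀ : ((k⁻¹ : G) : Matrix (Fin 2) (Fin 2) ℝ) 0 1 = w₀ at *
  generalize hw₁ : ((k⁻¹ : G) : Matrix (Fin 2) (Fin 2) ℝ) 1 1 = w₁ at *
  generalize ha : (h : Matrix (Fin 2) (Fin 2) ℝ) 0 0 = a at *
  generalize hb : (h : Matrix (Fin 2) (Fin 2) ℝ) 0 1 = b at *
  generalize hc : (h : Matrix (Fin 2) (Fin 2) ℝ) 1 0 = c at *
  generalize hd : (h : Matrix (Fin 2) (Fin 2) ℝ) 1 1 = d at *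
  have hM0 : ∀ N, ((h * γ N * k⁻¹ : G) : Matrix (Fin 2) (Fin 2) ℝ) 0 1 =
      (a * w₀ + b * w₁) + N * ((m * w₁ - n * w₀) * (a * m + b * n)) := by
    intro N
    simp only [Matrix.SpecialLinearGroup.coe_mul, Matrix.mul_apply, Fin.sum_univ_two, hγ0, ha, hb,
      hw₀, hw₁, Matrix.of_apply, Matrix.cons_val', Matrix.cons_val_zero, Matrix.cons_val_one,
      Matrix.cons_val_fin_one]
    ring
  have hM1 : ∀ N, ((h * γ N * k⁻¹ : G) : Matrix (Fin 2) (Fin 2) ℝ) 1 1 =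
      (c * w₀ + d * w₁) + N * ((m * w₁ - n * w₀) * (c * m + d * n)) := by
    intro N
    simp only [Matrix.SpecialLinearGroup.coe_mul, Matrix.mul_apply, Fin.sum_univ_two, hγ0, hc, hd,
      hw₀, hw₁, Matrix.of_apply, Matrix.cons_val', Matrix.cons_val_zero, Matrix.cons_val_one,
      Matrix.cons_val_fin_one]
    ring
  set D : ℝ := m * w₁ - n * w₀
  have hD2 : 0 < D ^ 2 := by positivity
  set s₀ : ℝ := a * m + b * n
  set s₁ : ℝ := c * m + d * n
  set v₀ : ℝ := a * w₀ + b * w₁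
  set v₁ : ℝ := c * w₀ + d * w₁
  obtain ⟨N₁, hN₁⟩ := exists_nat_forall_quadratic_pos (-(v₀ * v₁)) (-(D * (v₀ * s₁ + v₁ * s₀)))
    (D := -(D ^ 2 * (s₀ * s₁))) (by linarith [mul_neg_of_pos_of_neg hD2 h1])
  obtain ⟨N₂, hN₂⟩ := exists_nat_forall_quadratic_pos (v₁ ^ 2 + 2 * (v₀ * v₁))
    (2 * D * (v₁ * s₁) + 2 * (D * (v₀ * s₁ + v₁ * s₀)))
    (D := D ^ 2 * (s₁ ^ 2 + 2 * (s₀ * s₁))) (by positivity)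
  have hp1 := hN₁ (max N₁ N₂) (le_max_left _ _)
  have hp2 := hN₂ (max N₁ N₂) (le_max_right _ _)
  set N := max N₁ N₂
  have hM0N := hM0 N
  have hM1N := hM1 N
  set x := v₀ + N * (D * s₀) with hx
  set y := v₁ + N * (D * s₁) with hy
  have hxy : x * y < 0 := by rw [hx, hy]; linarith
  have hxy2 : 0 < y ^ 2 + 2 * (x * y) := by rw [hx, hy]; linarith
  rcases lt_trichotomy y 0 with hy0 | hy0 | hy0
  · have hneg : (-1 : G) ∈ Γ := by
      refine ⟨-1, Subtype.ext ?_⟩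
      change (Int.castRingHom ℝ).mapMatrix (-1) = -1
      rw [map_neg, map_one]
    refine ⟨γ N * -1, mul_mem (hγΓ N) hneg, ?_⟩
    have hmul : h * (γ N * -1) * k⁻¹ = -(h * γ N * k⁻¹) := by
      rw [mul_neg, mul_one, mul_neg, neg_mul]
    rw [hmul, Matrix.SpecialLinearGroup.coe_neg, Matrix.neg_apply, Matrix.neg_apply, hM0N, hM1N]
    exact ⟨neg_pos.2 hy0, sector_of_quadratic (by linarith) (by linarith) (neg_pos.2 hy0)⟩
  · simp [hy0] at hxy
  · refine ⟨γ N, hγΓ N, ?_⟩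
    rw [hM0N, hM1N]
    exact ⟨hy0, sector_of_quadratic hxy hxy2 hy0⟩

/-- Any two lattices without short vectors are connected in bounded time: a small push along the
expanding horocycle and a bounded flow move the first onto the contracted horocycle of the
second. -/
lemma exists_connection {ε : ℝ} (hε : 0 < ε) :
    ∃ C : ℝ, 0 < C ∧ ∀ Λ₁ Λ₂ : X, LongVectors ε Λ₁ → LongVectors ε Λ₂ →
      ∃ x τ y : ℝ, 0 ≤ x ∧ x ≤ 1 / 2 ∧ |τ| ≤ C ∧ |y| ≤ C ∧
        diagFlow τ • unip x • Λ₁ = lowUnip y • Λ₂ := by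
  set K : Set G := {g : G | ∀ i j, |(g : Matrix (Fin 2) (Fin 2) ℝ) i j| ≤ 2 / ε} with hK
  have hKc : IsCompact K := isCompact_setOf_abs_le (2 / ε)
  obtain ⟨C, hC, H⟩ : ∃ C : ℝ, 0 < C ∧ ∀ hk ∈ K ×ˢ K, ∃ γ ∈ Γ, ∃ M : G, M = hk.1 * γ * hk.2⁻¹ ∧
      Real.exp (-C) < (M : Matrix (Fin 2) (Fin 2) ℝ) 1 1 ∧
      (M : Matrix (Fin 2) (Fin 2) ℝ) 1 1 < Real.exp C ∧
      (M : Matrix (Fin 2) (Fin 2) ℝ) 0 1 < 0 ∧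
      0 < (M : Matrix (Fin 2) (Fin 2) ℝ) 1 1 + 2 * (M : Matrix (Fin 2) (Fin 2) ℝ) 0 1 ∧
      |(M : Matrix (Fin 2) (Fin 2) ℝ) 1 0| < C * (M : Matrix (Fin 2) (Fin 2) ℝ) 1 1 := by
    refine (hKc.prod hKc).induction_on (p := fun s => ∃ C : ℝ, 0 < C ∧ ∀ hk ∈ s, ∃ γ ∈ Γ, ∃ M : G,
      M = hk.1 * γ * hk.2⁻¹ ∧
      Real.exp (-C) < (M : Matrix (Fin 2) (Fin 2) ℝ) 1 1 ∧
      (M : Matrix (Fin 2) (Fin 2) ℝ) 1 1 < Real.exp C ∧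
      (M : Matrix (Fin 2) (Fin 2) ℝ) 0 1 < 0 ∧
      0 < (M : Matrix (Fin 2) (Fin 2) ℝ) 1 1 + 2 * (M : Matrix (Fin 2) (Fin 2) ℝ) 0 1 ∧
      |(M : Matrix (Fin 2) (Fin 2) ℝ) 1 0| < C * (M : Matrix (Fin 2) (Fin 2) ℝ) 1 1)
      ⟨1, one_pos, by simp⟩ ?_ ?_ ?_
    · rintro s t hst ⟨C, hC, H⟩
      exact ⟨C, hC, fun hk hhk => H hk (hst hhk)⟩
    · have mono : ∀ {C C' : ℝ} {hk : G × G}, C ≤ C' → (∃ γ ∈ Γ, ∃ M : G, M = hk.1 * γ * hk.2⁻¹ ∧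
          Real.exp (-C) < (M : Matrix (Fin 2) (Fin 2) ℝ) 1 1 ∧
          (M : Matrix (Fin 2) (Fin 2) ℝ) 1 1 < Real.exp C ∧
          (M : Matrix (Fin 2) (Fin 2) ℝ) 0 1 < 0 ∧
          0 < (M : Matrix (Fin 2) (Fin 2) ℝ) 1 1 + 2 * (M : Matrix (Fin 2) (Fin 2) ℝ) 0 1 ∧
          |(M : Matrix (Fin 2) (Fin 2) ℝ) 1 0| < C * (M : Matrix (Fin 2) (Fin 2) ℝ) 1 1) →
          ∃ γ ∈ Γ, ∃ M : G, M = hk.1 * γ * hk.2⁻¹ ∧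
          Real.exp (-C') < (M : Matrix (Fin 2) (Fin 2) ℝ) 1 1 ∧
          (M : Matrix (Fin 2) (Fin 2) ℝ) 1 1 < Real.exp C' ∧
          (M : Matrix (Fin 2) (Fin 2) ℝ) 0 1 < 0 ∧
          0 < (M : Matrix (Fin 2) (Fin 2) ℝ) 1 1 + 2 * (M : Matrix (Fin 2) (Fin 2) ℝ) 0 1 ∧
          |(M : Matrix (Fin 2) (Fin 2) ℝ) 1 0| < C' * (M : Matrix (Fin 2) (Fin 2) ℝ) 1 1 := by
        rintro C C' hk hCC ⟨γ, hγ, M, hM, h1, h2, h3, h4, h5⟩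
        refine ⟨γ, hγ, M, hM, lt_of_le_of_lt (Real.exp_le_exp.2 (by linarith)) h1,
          h2.trans_le (Real.exp_le_exp.2 hCC), h3, h4, h5.trans_le ?_⟩
        exact mul_le_mul_of_nonneg_right hCC ((Real.exp_pos _).trans h1).le
      rintro s t ⟨C, hC, H⟩ ⟨C', hC', H'⟩
      refine ⟨max C C', by positivity, ?_⟩
      rintro hk (hhk | hhk)
      · exact mono (le_max_left _ _) (H hk hhk)
      · exact mono (le_max_right _ _) (H' hk hhk)
    · rintro ⟨h, k⟩ -
      obtain ⟨γ, hγ, h1, h2, h3⟩ := exists_mem_Γ_mul_inv_mem_sector h k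
      set M₀ : G := h * γ * k⁻¹
      set m₁ := (M₀ : Matrix (Fin 2) (Fin 2) ℝ) 1 1
      set m₂ := (M₀ : Matrix (Fin 2) (Fin 2) ℝ) 1 0
      set C : ℝ := |Real.log m₁| + |m₂| / m₁ + 1 with hCdef
      have hC : 0 < C := by positivity
      have hquot : 0 ≤ |m₂| / m₁ := by positivity
      have hCl : |Real.log m₁| < C := by linarith
      set f : G × G → G := fun hk => hk.1 * γ * hk.2⁻¹ with hf
      have hfc : Continuous f := by fun_prop
      set W : Set G := {M | Real.exp (-C) < (M : Matrix (Fin 2) (Fin 2) ℝ) 1 1} ∩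
        ({M | (M : Matrix (Fin 2) (Fin 2) ℝ) 1 1 < Real.exp C} ∩
        ({M | (M : Matrix (Fin 2) (Fin 2) ℝ) 0 1 < 0} ∩
        ({M | 0 < (M : Matrix (Fin 2) (Fin 2) ℝ) 1 1 + 2 * (M : Matrix (Fin 2) (Fin 2) ℝ) 0 1} ∩
        {M | |(M : Matrix (Fin 2) (Fin 2) ℝ) 1 0| < C * (M : Matrix (Fin 2) (Fin 2) ℝ) 1 1})))
      have hWo : IsOpen W := by
        refine (isOpen_lt ?_ ?_).inter ((isOpen_lt ?_ ?_).inter ((isOpen_lt ?_ ?_).inter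
          ((isOpen_lt ?_ ?_).inter (isOpen_lt ?_ ?_)))) <;> fun_prop
      have hW : M₀ ∈ W := by
        refine ⟨?_, ?_, h2, h3, ?_⟩
        · rw [Set.mem_ofPred_eq, ← Real.lt_log_iff_exp_lt h1]
          linarith [neg_abs_le (Real.log m₁)]
        · rw [Set.mem_ofPred_eq, ← Real.log_lt_iff_lt_exp h1]
          linarith [le_abs_self (Real.log m₁)]
        · rw [Set.mem_ofPred_eq, ← div_lt_iff₀ h1]
          linarith [abs_nonneg (Real.log m₁)]
      refine ⟨f ⁻¹' W, mem_nhdsWithin_of_mem_nhds ((hWo.preimage hfc).mem_nhds hW), C, hC, ?_⟩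
      rintro hk ⟨h4, h5, h6, h7, h8⟩
      exact ⟨γ, hγ, f hk, rfl, h4, h5, h6, h7, h8⟩
  refine ⟨C, hC, fun Λ₁ Λ₂ h₁ h₂ => ?_⟩
  obtain ⟨h, hh, hhb⟩ := h₁.exists_rep_abs_le hε
  obtain ⟨k, hk, hkb⟩ := h₂.exists_rep_abs_le hε
  obtain ⟨γ, hγ, M, hM, h1, h2, h3, h4, h5⟩ := H (h, k) ⟨hhb, hkb⟩
  have hdet := M.det_coe
  rw [Matrix.det_fin_two] at hdet
  have hpos : 0 < (M : Matrix (Fin 2) (Fin 2) ℝ) 1 1 := (Real.exp_pos _).trans h1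
  refine ⟨-(M : Matrix (Fin 2) (Fin 2) ℝ) 0 1 / (M : Matrix (Fin 2) (Fin 2) ℝ) 1 1,
    Real.log ((M : Matrix (Fin 2) (Fin 2) ℝ) 1 1),
    (M : Matrix (Fin 2) (Fin 2) ℝ) 1 0 / (M : Matrix (Fin 2) (Fin 2) ℝ) 1 1, ?_, ?_, ?_, ?_, ?_⟩
  · exact div_nonneg (by linarith) hpos.le
  · rw [div_le_iff₀ hpos]; linarith
  · rw [abs_le]
    exact ⟨((Real.lt_log_iff_exp_lt hpos).2 h1).le, ((Real.log_lt_iff_lt_exp hpos).2 h2).le⟩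
  · rw [abs_div, abs_of_pos hpos, div_le_iff₀ hpos]; exact h5.le
  · have hMeq : diagFlow (Real.log ((M : Matrix (Fin 2) (Fin 2) ℝ) 1 1)) *
        unip (-(M : Matrix (Fin 2) (Fin 2) ℝ) 0 1 / (M : Matrix (Fin 2) (Fin 2) ℝ) 1 1) * M =
        lowUnip ((M : Matrix (Fin 2) (Fin 2) ℝ) 1 0 / (M : Matrix (Fin 2) (Fin 2) ℝ) 1 1) := by
      apply Subtype.ext
      rw [Matrix.SpecialLinearGroup.coe_mul, Matrix.SpecialLinearGroup.coe_mul, coe_diagFlow,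
        coe_unip, coe_lowUnip, Real.exp_neg, Real.exp_log hpos]
      ext i j
      fin_cases i <;> fin_cases j <;>
        simp [Matrix.mul_apply, Fin.sum_univ_two]
      · field_simp; linarith
      · field_simp; ring
      · field_simp
      · field_simp
    rw [← hh, ← hk]
    change QuotientGroup.mk (_ * (_ * h)) = QuotientGroup.mk (_ * k)
    rw [← hMeq, hM, ← QuotientGroup.mk_mul_of_mem _ hγ]
    congr 1
    group

/-! ### Shadowing a bounded orbit -/

/-- Every lattice without `ε`-short vectors can be steered, by a small push along the expanding
horocycle, so as to follow the bounded orbit of `Λ`: in flow time `W` it passes within `O(e^{-W})` of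
`Λ`, and it ends, together with the whole horocyclic segment of unit length at that time, without
`ε`-short vectors. -/
lemma exists_shadowing {ε₀ ε : ℝ} {Λ : X} (hΛ : ∀ t : ℝ, LongVectors ε₀ (diagFlow t • Λ))
    (hε : 0 < ε) (hle : ε ≤ ε₀ / 4) :
    ∃ C ε₁ W₀ : ℝ, 0 < C ∧ 0 < ε₁ ∧ 0 < W₀ ∧ ∀ W : ℝ, W₀ ≤ W → ∀ Λ' : X, LongVectors ε Λ' →
      ∃ x : ℝ, 0 ≤ x ∧ x ≤ 1 / 2 ∧ ∀ z : ℝ, 0 ≤ z → z ≤ 1 →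
        LongVectors ε (diagFlow W • unip (x + z * Real.exp (-2 * W)) • Λ') ∧
        (∀ s : ℝ, 0 ≤ s → s ≤ W →
          LongVectors ε₁ (diagFlow s • unip (x + z * Real.exp (-2 * W)) • Λ')) ∧
        ∃ s a b : ℝ, 0 ≤ s ∧ |a| ≤ C * Real.exp (-W) ∧ |b| ≤ C * Real.exp (-W) ∧
          diagFlow s • unip (x + z * Real.exp (-2 * W)) • Λ' = unip a • lowUnip b • Λ := by
  obtain ⟨C₀, hC₀, hconn⟩ := exists_connection hε
  have hε₀ : 0 < ε₀ := by linarith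
  have hE1 : 1 ≤ Real.exp (2 * C₀) := Real.one_le_exp (by linarith)
  set C : ℝ := (C₀ + 1) * Real.exp (2 * C₀) with hC
  have hCpos : 0 < C := by positivity
  refine ⟨C, ε₀ / (1 + C) / (1 + 1), C + 2 * C₀, hCpos, by positivity, by positivity,
    fun W hW Λ' hΛ' => ?_⟩
  obtain ⟨x, τ, y, hx0, hx1, hτ, hy, heq⟩ := hconn Λ' (diagFlow (-(W / 2)) • Λ) hΛ'
    ((hΛ _).mono (by linarith))
  obtain ⟨hτ1, hτ2⟩ := abs_le.1 hτ
  refine ⟨x, hx0, hx1, fun z hz0 hz1 => ?_⟩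
  have key : ∀ s : ℝ, diagFlow s • unip (x + z * Real.exp (-2 * W)) • Λ' =
      unip (z * Real.exp (2 * (s - W))) • lowUnip (Real.exp (-2 * (s - τ)) * y) •
        diagFlow (s - τ - W / 2) • Λ := by
    intro s
    have h1 : diagFlow s * unip (x + z * Real.exp (-2 * W)) =
        unip (z * Real.exp (2 * (s - W))) * (diagFlow (s - τ) * (diagFlow τ * unip x)) := by
      rw [← mul_assoc (diagFlow (s - τ)), diagFlow_mul_diagFlow, sub_add_cancel, ← mul_assoc,
        add_comm x, ← unip_mul_unip, ← mul_assoc, diagFlow_mul_unip]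
      congr 3
      rw [mul_left_comm, ← Real.exp_add]
      ring_nf
    rw [smul_smul, h1, mul_smul, mul_smul, mul_smul, heq, smul_smul (diagFlow (s - τ)),
      diagFlow_mul_lowUnip, mul_smul, smul_smul (diagFlow (s - τ)), diagFlow_mul_diagFlow]
    rfl
  have hyC : ∀ s : ℝ, |Real.exp (-2 * (s - τ)) * y| ≤ C * Real.exp (-2 * s) := by
    intro s
    rw [abs_mul, Real.abs_exp]
    have h1 : Real.exp (-2 * (s - τ)) ≤ Real.exp (2 * C₀) * Real.exp (-2 * s) := by
      rw [← Real.exp_add]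
      exact Real.exp_le_exp.2 (by linarith)
    calc Real.exp (-2 * (s - τ)) * |y|
        ≤ (Real.exp (2 * C₀) * Real.exp (-2 * s)) * (C₀ + 1) := by gcongr; linarith
      _ = _ := by rw [hC]; ring
  have hWC : C * Real.exp (-W) ≤ 1 := by
    rw [Real.exp_neg, ← div_eq_mul_inv, div_le_one (Real.exp_pos _)]
    linarith [Real.add_one_le_exp W]
  have hW0 : 0 < W := by linarith
  refine ⟨?_, fun s hs0 hsW => ?_, ?_⟩
  · rw [key W]
    refine (((hΛ (W - τ - W / 2)).lowUnip_smul _).unip_smul _).mono ?_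
    have hb : |Real.exp (-2 * (W - τ)) * y| ≤ 1 := by
      refine (hyC W).trans (le_trans ?_ hWC)
      gcongr; linarith
    have ha : |z * Real.exp (2 * (W - W))| ≤ 1 := by
      rw [sub_self, mul_zero, Real.exp_zero, mul_one, abs_of_nonneg hz0]; exact hz1
    rw [div_div]
    refine hle.trans ?_
    apply div_le_div_of_nonneg_left hε₀.le (by positivity)
    nlinarith [abs_nonneg (Real.exp (-2 * (W - τ)) * y), abs_nonneg (z * Real.exp (2 * (W - W)))]
  · rw [key s]
    refine (((hΛ (s - τ - W / 2)).lowUnip_smul _).unip_smul _).mono ?_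
    have hb : |Real.exp (-2 * (s - τ)) * y| ≤ C := by
      refine (hyC s).trans ?_
      exact mul_le_of_le_one_right hCpos.le (Real.exp_le_one_iff.2 (by linarith))
    have ha : |z * Real.exp (2 * (s - W))| ≤ 1 := by
      rw [abs_mul, Real.abs_exp, abs_of_nonneg hz0]
      exact mul_le_one₀ hz1 (Real.exp_pos _).le (Real.exp_le_one_iff.2 (by linarith))
    gcongr
  · refine ⟨τ + W / 2, z * Real.exp (2 * (τ + W / 2 - W)),
      Real.exp (-2 * (τ + W / 2 - τ)) * y, by linarith, ?_, ?_, ?_⟩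
    · rw [abs_mul, Real.abs_exp, abs_of_nonneg hz0]
      have h1 : Real.exp (2 * (τ + W / 2 - W)) ≤ Real.exp (2 * C₀) * Real.exp (-W) := by
        rw [← Real.exp_add]
        exact Real.exp_le_exp.2 (by linarith)
      calc z * Real.exp (2 * (τ + W / 2 - W))
          ≤ (C₀ + 1) * (Real.exp (2 * C₀) * Real.exp (-W)) := by gcongr; linarith
        _ = _ := by rw [hC]; ring
    · have h1 : -2 * (τ + W / 2 - τ) = -W := by ring
      have h2 : |y| ≤ C := by rw [hC]; nlinarith
      rw [h1, abs_mul, Real.abs_exp, mul_comm]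
      gcongr
    · rw [key]
      have : τ + W / 2 - τ - W / 2 = 0 := by ring
      rw [this, diagFlow_zero, one_smul]

/-! ### Branching -/

lemma exists_int_det_eq {Λ : X} {v w : Fin 2 → ℝ} (hv : v ∈ vectors Λ) (hw : w ∈ vectors Λ) :
    ∃ n : ℤ, v 0 * w 1 - v 1 * w 0 = n := by
  obtain ⟨g, rfl⟩ := QuotientGroup.mk_surjective Λ
  obtain ⟨m, rfl⟩ := hv
  obtain ⟨k, rfl⟩ := hw
  have hdet := g.det_coe
  rw [Matrix.det_fin_two] at hdet
  refine ⟨m 0 * k 1 - m 1 * k 0, ?_⟩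
  have h0 : ∀ m : Fin 2 → ℤ, ((g : Matrix (Fin 2) (Fin 2) ℝ) *ᵥ fun i => (m i : ℝ)) 0 = _ :=
    fun m => mulVec_apply_zero _ _
  have h1 : ∀ m : Fin 2 → ℤ, ((g : Matrix (Fin 2) (Fin 2) ℝ) *ᵥ fun i => (m i : ℝ)) 1 = _ :=
    fun m => mulVec_apply_one _ _
  refine (congrArg₂ (· - ·) (congrArg₂ (· * ·) (h0 m) (h1 k))
    (congrArg₂ (· * ·) (h1 m) (h0 k))).trans ?_
  push_cast
  linear_combination (m 0 * k 1 - m 1 * k 0 : ℝ) * hdet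

/-- If no lattice on a unit horocyclic segment has an `ε`-short vector, then after time `T`, when
the segment has been stretched to length `8M = e^{2T}`, at least `M` disjoint unit subsegments have
the same property: vectors that become short at time `T` are all collinear, so the parameters at
which they do so lie within `e^{-T}` of one point. -/
lemma exists_branching {M : ℕ} (hM : 2 ≤ M) {T : ℝ} (hT : Real.exp (2 * T) = 8 * M) {ε : ℝ}
    (hε : 0 < ε) (hεT : 4 * ε * Real.exp T ≤ 1) {Λ : X}
    (hΛ : ∀ x : ℝ, 0 ≤ x → x ≤ 1 → LongVectors ε (unip x • Λ)) :
    ∃ o : ℝ, 0 ≤ o ∧ o ≤ 3 / 4 ∧ ∀ i : Fin M, ∀ z : ℝ, 0 ≤ z → z ≤ 1 →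
      LongVectors ε (diagFlow T • unip (o + (2 * i + z) / (8 * M)) • Λ) := by
  have hMR : (2 : ℝ) ≤ M := by exact_mod_cast hM
  set Q := Real.exp T with hQ
  have hQ2 : Q ^ 2 = 8 * M := by rw [← hT, hQ, ← Real.exp_nat_mul]; norm_num
  have hQ0 : 0 < Q := Real.exp_pos T
  have hQ4 : 4 ≤ Q := by nlinarith
  -- The offsets of the subsegments of one family fill `[0, 1/4]`.
  have hrange : ∀ i : Fin M, ∀ z : ℝ, 0 ≤ z → z ≤ 1 →
      0 ≤ (2 * i + z) / (8 * M) ∧ (2 * i + z) / (8 * M) ≤ 1 / 4 := by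
    intro i z hz0 hz1
    refine ⟨by positivity, ?_⟩
    rw [div_le_iff₀ (by positivity)]
    have : (i : ℝ) + 1 ≤ M := by exact_mod_cast i.2
    linarith
  have hshort : ∀ x v, ‖(diagFlow T : Matrix (Fin 2) (Fin 2) ℝ) *ᵥ
      ((unip x : Matrix (Fin 2) (Fin 2) ℝ) *ᵥ v)‖ < ε → v ∈ vectors Λ → v ≠ 0 → 0 ≤ x → x ≤ 1 →
      |v 0 + x * v 1| < ε / Q ∧ ε ≤ |v 1| ∧ |v 1| < ε * Q ∧ |v 0| < 2 * ε * Q := by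
    intro x v hlt hv hv0 hx0 hx1
    rw [unip_mulVec, diagFlow_mulVec, norm_eq_max, max_lt_iff, Real.exp_neg] at hlt
    simp only [Matrix.cons_val_zero, Matrix.cons_val_one, abs_mul, abs_inv, Real.abs_exp] at hlt
    rw [← hQ, inv_mul_eq_div, div_lt_iff₀ hQ0] at hlt
    have h1 : |v 0 + x * v 1| < ε / Q := by rw [lt_div_iff₀ hQ0]; linarith [hlt.1]
    have h2 := forall_vectors_smul.1 (hΛ x hx0 hx1) v hv hv0
    rw [unip_mulVec, norm_eq_max, le_max_iff] at h2
    simp only [Matrix.cons_val_zero, Matrix.cons_val_one] at h2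
    have h3 : ε / Q < ε := div_lt_self hε (by linarith)
    have h4 : |v 0| ≤ |v 0 + x * v 1| + |x| * |v 1| := by
      rw [← abs_mul]
      simpa using abs_sub (v 0 + x * v 1) (x * v 1)
    have h5 : |x| * |v 1| ≤ |v 1| := by
      rw [abs_of_nonneg hx0]
      exact mul_le_of_le_one_left (abs_nonneg _) hx1
    have h6 : ε ≤ ε * Q := le_mul_of_one_le_right hε.le (by linarith)
    exact ⟨h1, h2.resolve_left (by linarith), hlt.2, by linarith⟩
  by_cases hbad : ∃ x v, ‖(diagFlow T : Matrix (Fin 2) (Fin 2) ℝ) *ᵥ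
      ((unip x : Matrix (Fin 2) (Fin 2) ℝ) *ᵥ v)‖ < ε ∧ v ∈ vectors Λ ∧ v ≠ 0 ∧ 0 ≤ x ∧ x ≤ 1
  · obtain ⟨x₀, v, hlt, hv, hv0, hx0, hx1⟩ := hbad
    obtain ⟨-, h2, h3, h4⟩ := hshort x₀ v hlt hv hv0 hx0 hx1
    have hv1 : v 1 ≠ 0 := by
      intro h; rw [h, abs_zero] at h2; linarith
    have hnear : ∀ x, 0 ≤ x → x ≤ 1 → ¬ LongVectors ε (diagFlow T • unip x • Λ) →
        |v 0 / v 1 + x| < 1 / 4 := by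
      intro x hx0 hx1 hnot
      unfold LongVectors at hnot
      rw [forall_vectors_smul, forall_vectors_smul] at hnot
      push Not at hnot
      obtain ⟨w, hw, hw0, hwlt⟩ := hnot
      obtain ⟨h1', h2', h3', h4'⟩ := hshort x w hwlt hw hw0 hx0 hx1
      obtain ⟨n, hn⟩ := exists_int_det_eq hv hw
      have hn0 : n = 0 := by
        have h5 : |v 0 * w 1 - v 1 * w 0| < 1 := by
          have h6 : |v 0| * |w 1| ≤ 2 * ε * Q * (ε * Q) := by gcongr
          have h7 : |v 1| * |w 0| ≤ ε * Q * (2 * ε * Q) := by gcongr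
          have h8 : |v 0 * w 1 - v 1 * w 0| ≤ |v 0| * |w 1| + |v 1| * |w 0| := by
            rw [← abs_mul, ← abs_mul]; exact abs_sub _ _
          have h9 : 0 < ε * Q := by positivity
          nlinarith
        rw [hn] at h5
        exact Int.abs_lt_one_iff.1 (by exact_mod_cast h5)
      have hw1 : w 1 ≠ 0 := by
        intro h; rw [h, abs_zero] at h2'; linarith
      have hratio : v 0 / v 1 = w 0 / w 1 := by
        rw [hn0, Int.cast_zero] at hn
        rw [div_eq_div_iff hv1 hw1]; linarith
      have h10 : w 0 / w 1 + x = (w 0 + x * w 1) / w 1 := by field_simp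
      rw [hratio, h10, abs_div, div_lt_iff₀ (abs_pos.2 hw1)]
      have h11 : ε / Q ≤ ε / 4 := by gcongr
      linarith
    by_cases hξ : -(v 0 / v 1) ≤ 1 / 2
    · refine ⟨3 / 4, by norm_num, le_rfl, fun i z hz0 hz1 => ?_⟩
      obtain ⟨h5, h6⟩ := hrange i z hz0 hz1
      by_contra hnot
      have := (abs_lt.1 (hnear _ (by linarith) (by linarith) hnot)).2
      linarith
    · refine ⟨0, le_rfl, by norm_num, fun i z hz0 hz1 => ?_⟩
      obtain ⟨h5, h6⟩ := hrange i z hz0 hz1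
      by_contra hnot
      have := (abs_lt.1 (hnear _ (by linarith) (by linarith) hnot)).1
      linarith
  · refine ⟨0, le_rfl, by norm_num, fun i z hz0 hz1 => ?_⟩
    obtain ⟨h5, h6⟩ := hrange i z hz0 hz1
    refine forall_vectors_smul.2 (forall_vectors_smul.2 fun v hv hv0 => ?_)
    by_contra! hlt
    exact hbad ⟨_, v, hlt, hv, hv0, by linarith, by linarith⟩

/-! ### Branching and shadowing on intervals of parameters -/

/-- The interval of length `e^{-2t}` starting at `a`, which the flow at time `t` stretches to unit
length, is good if none of its parameters gives a lattice with an `ε`-short vector at time `t`. -/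
def IsGood (ε t a : ℝ) : Prop :=
  ∀ α ∈ Set.Icc a (a + Real.exp (-2 * t)), LongVectors ε (diagFlow t • latticeAt α)

lemma unip_smul_diagFlow_smul_latticeAt (x t a : ℝ) :
    unip x • diagFlow t • latticeAt a = diagFlow t • latticeAt (a + x * Real.exp (-2 * t)) := by
  have h : Real.exp (2 * t) * (x * Real.exp (-2 * t)) = x := by
    rw [mul_left_comm, ← Real.exp_add]; ring_nf; simp
  rw [add_comm a, ← unip_smul_latticeAt, smul_smul (diagFlow t), diagFlow_mul_unip, h, mul_smul]

lemma isGood_zero {ε : ℝ} (hε : ε ≤ 1) : IsGood ε 0 0 := by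
  intro α _
  have := longVectors_unip_smul_latticeAt_zero α
  rw [unip_smul_latticeAt, add_zero] at this
  rw [diagFlow_zero, one_smul]
  exact this.mono hε

lemma IsGood.exists_branching {M : ℕ} (hM : 2 ≤ M) {T : ℝ} (hT : Real.exp (2 * T) = 8 * M) {ε : ℝ}
    (hε : 0 < ε) (hεT : 4 * ε * Real.exp T ≤ 1) {t a : ℝ} (h : IsGood ε t a) :
    ∃ b : Fin M → ℝ, (∀ i, a ≤ b i ∧ b i + Real.exp (-2 * (t + T)) ≤ a + Real.exp (-2 * t) ∧
      IsGood ε (t + T) (b i)) ∧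
      ∀ i j, i < j → b i + Real.exp (-2 * (t + T)) + Real.exp (-2 * t) / (8 * M) ≤ b j := by
  have hM0 : (0 : ℝ) < 8 * M := by positivity
  have hlen : Real.exp (-2 * (t + T)) = Real.exp (-2 * t) / (8 * M) := by
    rw [← hT, ← Real.exp_sub]; ring_nf
  have hℓ := Real.exp_pos (-2 * t)
  set ℓ := Real.exp (-2 * t) with hℓdef
  obtain ⟨o, ho0, ho1, ho⟩ := NormDirichlet.exists_branching hM hT hε hεT
    (Λ := diagFlow t • latticeAt a) (by
      intro x hx0 hx1
      rw [unip_smul_diagFlow_smul_latticeAt]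
      refine h _ ⟨by nlinarith, by nlinarith⟩)
  refine ⟨fun i => a + (o + 2 * i / (8 * M)) * ℓ, fun i => ⟨?_, ?_, ?_⟩, ?_⟩
  · have : 0 ≤ (o + 2 * (i : ℝ) / (8 * M)) * ℓ := by positivity
    linarith
  · rw [hlen]
    have h1 : (2 * (i : ℝ) + 1) / (8 * M) ≤ 1 / 4 := by
      rw [div_le_iff₀ hM0]
      have : (i : ℝ) + 1 ≤ M := by exact_mod_cast i.2
      linarith
    have h2 : a + (o + 2 * (i : ℝ) / (8 * M)) * ℓ + ℓ / (8 * M) =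
      a + (o + (2 * (i : ℝ) + 1) / (8 * M)) * ℓ := by ring
    rw [h2]
    nlinarith
  · rintro α ⟨hα0, hα1⟩
    rw [hlen] at hα1
    set z := (α - (a + (o + 2 * (i : ℝ) / (8 * M)) * ℓ)) * (8 * M) / ℓ with hz
    have hz0 : 0 ≤ z := by
      rw [hz]
      exact div_nonneg (mul_nonneg (by linarith) hM0.le) hℓ.le
    have hz1 : z ≤ 1 := by
      rw [hz, div_le_one hℓ, ← le_div_iff₀ hM0]; linarith
    have hαz : a + (o + (2 * i + z) / (8 * M)) * ℓ = α := by
      rw [hz]; field_simp; ring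
    have := ho i z hz0 hz1
    rwa [unip_smul_diagFlow_smul_latticeAt, hαz, smul_smul, diagFlow_mul_diagFlow, add_comm T]
      at this
  · intro i j hij
    have h1 : (i : ℝ) + 1 ≤ j := by exact_mod_cast hij
    rw [hlen]
    have h2 : (2 * (i : ℝ) + 2) / (8 * M) ≤ 2 * j / (8 * M) := by gcongr; linarith
    have h3 : a + (o + 2 * (i : ℝ) / (8 * M)) * ℓ + ℓ / (8 * M) + ℓ / (8 * M) =
      a + (o + (2 * (i : ℝ) + 2) / (8 * M)) * ℓ := by ring
    rw [h3]
    change _ ≤ a + (o + 2 * (j : ℝ) / (8 * M)) * ℓ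
    gcongr

/-- Some point of the orbit of `Λ_α` at a time not before `t` is obtained from `Λ` by a matrix that is
`δ`-close to the identity. -/
def VisitsNear (Λ : X) (δ t α : ℝ) : Prop :=
  ∃ s a b : ℝ, t ≤ s ∧ |a| ≤ δ ∧ |b| ≤ δ ∧ diagFlow s • latticeAt α = unip a • lowUnip b • Λ

lemma exists_shadowing_interval {ε₀ ε : ℝ} {Λ : X}
    (hΛ : ∀ t : ℝ, LongVectors ε₀ (diagFlow t • Λ)) (hε : 0 < ε) (hle : ε ≤ ε₀ / 4) :
    ∃ C ε₁ W₀ : ℝ, 0 < C ∧ 0 < ε₁ ∧ 0 < W₀ ∧ ∀ W : ℝ, W₀ ≤ W → ∀ t a : ℝ, IsGood ε t a →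
      ∃ b : ℝ, a ≤ b ∧ b + Real.exp (-2 * (t + W)) ≤ a + Real.exp (-2 * t) ∧
        IsGood ε (t + W) b ∧ ∀ α ∈ Set.Icc b (b + Real.exp (-2 * (t + W))),
          (∀ s : ℝ, t ≤ s → s ≤ t + W → LongVectors ε₁ (diagFlow s • latticeAt α)) ∧
          VisitsNear Λ (C * Real.exp (-W)) t α := by
  obtain ⟨C, ε₁, W₀, hC, hε₁, hW₀, H⟩ := exists_shadowing hΛ hε hle
  refine ⟨C, ε₁, max W₀ 1, hC, hε₁, by positivity, fun W hW t a hgood => ?_⟩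
  have hW1 : 1 ≤ W := (le_max_right _ _).trans hW
  have hℓ := Real.exp_pos (-2 * t)
  have hlen : Real.exp (-2 * (t + W)) = Real.exp (-2 * W) * Real.exp (-2 * t) := by
    rw [← Real.exp_add]; ring_nf
  have heW := Real.exp_pos (-2 * W)
  have hhalf : Real.exp (-2 * W) ≤ 1 / 2 := by
    have h1 : -2 * W = -(2 * W) := by ring
    rw [h1, Real.exp_neg, ← one_div]
    exact one_div_le_one_div_of_le (by norm_num) (by linarith [Real.add_one_le_exp (2 * W)])
  obtain ⟨x, hx0, hx1, hx⟩ := H W ((le_max_left _ _).trans hW) (diagFlow t • latticeAt a)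
    (hgood a ⟨le_rfl, by linarith⟩)
  have key : ∀ α ∈ Set.Icc (a + x * Real.exp (-2 * t))
      (a + x * Real.exp (-2 * t) + Real.exp (-2 * (t + W))), ∃ z : ℝ, 0 ≤ z ∧ z ≤ 1 ∧
        unip (x + z * Real.exp (-2 * W)) • diagFlow t • latticeAt a =
          diagFlow t • latticeAt α := by
    rintro α ⟨hα0, hα1⟩
    refine ⟨(α - (a + x * Real.exp (-2 * t))) / Real.exp (-2 * (t + W)),
      div_nonneg (by linarith) (Real.exp_pos _).le, ?_, ?_⟩
    · rw [div_le_one (Real.exp_pos _)]; linarith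
    · rw [unip_smul_diagFlow_smul_latticeAt, hlen]
      congr 2
      field_simp
      ring
  refine ⟨a + x * Real.exp (-2 * t), by nlinarith, ?_, ?_, ?_⟩
  · rw [hlen]; nlinarith
  · intro α hα
    obtain ⟨z, hz0, hz1, hz⟩ := key α hα
    have := (hx z hz0 hz1).1
    rwa [hz, smul_smul, diagFlow_mul_diagFlow, add_comm W] at this
  · intro α hα
    obtain ⟨z, hz0, hz1, hz⟩ := key α hα
    obtain ⟨-, h2, s, p, q, hs, hp, hq, heq⟩ := hx z hz0 hz1
    rw [hz, smul_smul, diagFlow_mul_diagFlow] at heq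
    refine ⟨fun s hs0 hs1 => ?_, s + t, p, q, by linarith, hp, hq, heq⟩
    have := h2 (s - t) (by linarith) (by linarith)
    rwa [hz, smul_smul, diagFlow_mul_diagFlow, sub_add_cancel] at this

/-- One step of the Cantor construction: branching, followed by a shadowing of length `w` unless
`w = 0`. -/
lemma exists_children {ε₀ ε : ℝ} {Λ : X} (hΛ : ∀ t : ℝ, LongVectors ε₀ (diagFlow t • Λ))
    (hε : 0 < ε) (hle : ε ≤ ε₀ / 4) {M : ℕ} (hM : 2 ≤ M) {T : ℝ}
    (hT : Real.exp (2 * T) = 8 * M) (hεT : 4 * ε * Real.exp T ≤ 1) :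
    ∃ C ε₁ W₀ : ℝ, 0 < C ∧ 0 < ε₁ ∧ 0 < W₀ ∧ ∀ w : ℝ, (w = 0 ∨ W₀ ≤ w) → ∀ t a : ℝ,
      IsGood ε t a → ∃ b : Fin M → ℝ, (∀ i, a ≤ b i ∧
        b i + Real.exp (-2 * (t + T + w)) ≤ a + Real.exp (-2 * t) ∧ IsGood ε (t + T + w) (b i) ∧
        ∀ α ∈ Set.Icc (b i) (b i + Real.exp (-2 * (t + T + w))),
          (∀ s : ℝ, t ≤ s → s ≤ t + T + w → LongVectors ε₁ (diagFlow s • latticeAt α)) ∧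
          (W₀ ≤ w → VisitsNear Λ (C * Real.exp (-w)) t α)) ∧
      ∀ i j, i < j → b i + Real.exp (-2 * (t + T + w)) + Real.exp (-2 * t) / (8 * M) ≤ b j := by
  obtain ⟨C, ε₁, W₀, hC, hε₁, hW₀, H⟩ := exists_shadowing_interval hΛ hε hle
  have hT0 : 0 ≤ T := by
    have h2 : (2 : ℝ) ≤ M := by exact_mod_cast hM
    have : 0 ≤ 2 * T := by rw [← Real.one_le_exp_iff, hT]; linarith
    linarith
  refine ⟨C, min ε₁ (ε / Real.exp T), W₀, hC, by positivity, hW₀, fun w hw t a hgood => ?_⟩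
  obtain ⟨b, hb, hsep⟩ := hgood.exists_branching hM hT hε hεT
  have hbranch : ∀ i, ∀ α ∈ Set.Icc (b i) (b i + Real.exp (-2 * (t + T))), ∀ s : ℝ, t ≤ s →
      s ≤ t + T → LongVectors (min ε₁ (ε / Real.exp T)) (diagFlow s • latticeAt α) := by
    intro i α hα s hs0 hs1
    obtain ⟨h1, h2, -⟩ := hb i
    have := (hgood α ⟨h1.trans hα.1, hα.2.trans h2⟩).diagFlow_smul (s - t)
    rw [smul_smul, diagFlow_mul_diagFlow, sub_add_cancel] at this
    refine this.mono ((min_le_right _ _).trans ?_)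
    gcongr
    rw [abs_of_nonneg (by linarith)]; linarith
  rcases hw with rfl | hw
  · simp only [add_zero]
    refine ⟨b, fun i => ⟨(hb i).1, (hb i).2.1, (hb i).2.2, fun α hα => ⟨hbranch i α hα, ?_⟩⟩, hsep⟩
    intro h; linarith
  · choose c hc1 hc2 hc3 hc4 using fun i => H w hw (t + T) (b i) (hb i).2.2
    refine ⟨c, fun i => ⟨(hb i).1.trans (hc1 i), (hc2 i).trans (hb i).2.1, hc3 i, fun α hα => ?_⟩,
      fun i j hij => ?_⟩
    · obtain ⟨h1, s, p, q, hs, hpq⟩ := hc4 i α hα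
      refine ⟨fun s hs0 hs1 => ?_, fun _ => ⟨s, p, q, by linarith, hpq⟩⟩
      rcases le_total s (t + T) with hsT | hsT
      · exact hbranch i α ⟨(hc1 i).trans hα.1, hα.2.trans (hc2 i)⟩ s hs0 hsT
      · exact (h1 s hsT hs1).mono (min_le_left _ _)
    · linarith [hsep i j hij, hc2 i, hc1 j]

/-! ### Hausdorff dimension of a set parametrized by digit sequences -/

open scoped NNReal ENNReal in
/-- If points whose digit sequences first differ at the `n`-th place have distance at least a
constant multiple of `M^{-n/s}`, then the set of these points has dimension at least `s`: reading
the digits as an expansion in base `M` maps it onto `[0, 1]` by an `s`-Hölder function. -/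
lemma le_dimH_range_of_digits {M : ℕ} (hM : 1 < M) {x : (ℕ → Fin M) → ℝ} {K s : ℝ≥0} (hs : 0 < s)
    (h : ∀ (d d' : ℕ → Fin M) (n : ℕ), (∀ i < n, d i = d' i) → d n ≠ d' n →
      ((M : ℝ) ^ n)⁻¹ ≤ K * |x d - x d'| ^ (s : ℝ)) :
    (s : ℝ≥0∞) ≤ dimH (Set.range x) := by
  have hfirst : ∀ d d' : ℕ → Fin M, d ≠ d' → ∃ n, (∀ i < n, d i = d' i) ∧ d n ≠ d' n := by
    intro d d' hne
    have hex : ∃ n, d n ≠ d' n := Function.ne_iff.1 hne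
    classical
    exact ⟨Nat.find hex, fun i hi => not_not.1 (Nat.find_min hex hi), Nat.find_spec hex⟩
  have hinj : Function.Injective x := by
    intro d d' heq
    by_contra hne
    obtain ⟨n, hn, hn'⟩ := hfirst d d' hne
    have h1 := h d d' n hn hn'
    rw [heq, sub_self, abs_zero, Real.zero_rpow (by exact_mod_cast hs.ne'), mul_zero] at h1
    have : (0 : ℝ) < M := by exact_mod_cast (by omega : 0 < M)
    have : 0 < ((M : ℝ) ^ n)⁻¹ := by positivity
    linarith
  have : Nonempty (ℕ → Fin M) := ⟨fun _ => ⟨0, by omega⟩⟩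
  set g : ℝ → ℝ := fun e => Real.ofDigits (Function.invFun x e) with hg
  have hgx : ∀ d, g (x d) = Real.ofDigits d := fun d => by
    rw [hg]; simp only [Function.leftInverse_invFun hinj d]
  have hholder : HolderOnWith K s g (Set.range x) := by
    rintro _ ⟨d, rfl⟩ _ ⟨d', rfl⟩
    rw [hgx, hgx, edist_dist, edist_dist, ENNReal.ofReal_rpow_of_nonneg dist_nonneg s.coe_nonneg,
      ← ENNReal.ofReal_coe_nnreal, ← ENNReal.ofReal_mul K.coe_nonneg]
    refine ENNReal.ofReal_le_ofReal ?_
    rw [Real.dist_eq, Real.dist_eq]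
    by_cases hdd : d = d'
    · subst hdd
      rw [sub_self, abs_zero]; positivity
    · obtain ⟨n, hn, hn'⟩ := hfirst d d' hdd
      exact (Real.abs_ofDigits_sub_ofDigits_le hn).trans (h d d' n hn hn')
  have hsub : Set.Icc (0 : ℝ) 1 ⊆ g '' Set.range x := by
    intro y hy
    obtain ⟨d, -, rfl⟩ := Real.ofDigits_SurjOn hM hy
    exact ⟨x d, ⟨d, rfl⟩, hgx d⟩
  have h1 : (1 : ℝ≥0∞) ≤ dimH (Set.range x) / s := by
    have hI : dimH (Set.Icc (0 : ℝ) 1) = 1 := by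
      rw [Real.dimH_of_nonempty_interior (by rw [interior_Icc]; exact ⟨1 / 2, by norm_num⟩)]
      simp
    rw [← hI]
    exact (dimH_mono hsub).trans (hholder.dimH_image_le hs)
  rw [ENNReal.le_div_iff_mul_le (Or.inl (by exact_mod_cast hs.ne')) (Or.inl ENNReal.coe_ne_top),
    one_mul] at h1
  exact h1

/-! ### The Cantor set -/

/-- The total length of the shadowings in the first `n` steps of the construction. It is `o(n)`,
constant unless `n` is a power of two, and its jumps are at least `W₀` and tend to infinity. -/
noncomputable def shadowTime (W₀ : ℝ) (n : ℕ) : ℝ := Nat.log 2 n * (W₀ + Nat.log 2 n)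

lemma shadowTime_succ_sub (W₀ : ℝ) (hW₀ : 0 < W₀) (n : ℕ) :
    shadowTime W₀ (n + 1) - shadowTime W₀ n = 0 ∨
      W₀ ≤ shadowTime W₀ (n + 1) - shadowTime W₀ n := by
  rcases (Nat.log_mono_right (b := 2) n.le_succ).eq_or_lt with h | h
  · left; rw [shadowTime, shadowTime, h, sub_self]
  · right
    have h1 : (Nat.log 2 n : ℝ) + 1 ≤ Nat.log 2 (n + 1) := by exact_mod_cast h
    have h2 : (0 : ℝ) ≤ Nat.log 2 n := Nat.cast_nonneg _
    rw [shadowTime, shadowTime]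
    nlinarith

lemma le_shadowTime_succ_sub (W₀ : ℝ) (hW₀ : 0 < W₀) (j : ℕ) :
    W₀ + j ≤ shadowTime W₀ (2 ^ (j + 1) - 1 + 1) - shadowTime W₀ (2 ^ (j + 1) - 1) := by
  have h1 : Nat.log 2 (2 ^ (j + 1) - 1) ≤ j := by
    have : Nat.log 2 (2 ^ (j + 1) - 1) < j + 1 :=
      Nat.log_lt_of_lt_pow' (by omega) (Nat.sub_lt (by positivity) one_pos)
    omega
  have h2 : 2 ^ (j + 1) - 1 + 1 = 2 ^ (j + 1) := Nat.sub_add_cancel Nat.one_le_two_pow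
  have h3 : (Nat.log 2 (2 ^ (j + 1) - 1) : ℝ) ≤ j := by exact_mod_cast h1
  rw [h2, shadowTime, shadowTime, Nat.log_pow (by norm_num)]
  push_cast
  have h4 : (0 : ℝ) ≤ Nat.log 2 (2 ^ (j + 1) - 1) := Nat.cast_nonneg _
  have h5 : (Nat.log 2 (2 ^ (j + 1) - 1) : ℝ) * (W₀ + Nat.log 2 (2 ^ (j + 1) - 1)) ≤
      j * (W₀ + j) := by gcongr
  nlinarith

lemma shadowTime_nonneg {W₀ : ℝ} (hW₀ : 0 < W₀) (n : ℕ) : 0 ≤ shadowTime W₀ n := by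
  rw [shadowTime]; positivity

lemma exists_shadowTime_le (W₀ : ℝ) (hW₀ : 0 < W₀) {κ : ℝ} (hκ : 0 < κ) :
    ∃ B : ℝ, ∀ n, shadowTime W₀ n ≤ κ * n + B := by
  have h1 : Filter.Tendsto (fun k : ℕ => W₀ * ((k : ℝ) ^ 1 / 2 ^ k) + (k : ℝ) ^ 2 / 2 ^ k)
      Filter.atTop (nhds (W₀ * 0 + 0)) :=
    ((tendsto_pow_const_div_const_pow_of_one_lt 1 one_lt_two).const_mul W₀).add
      (tendsto_pow_const_div_const_pow_of_one_lt 2 one_lt_two)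
  rw [mul_zero, add_zero] at h1
  obtain ⟨N, hN⟩ := Filter.eventually_atTop.1 (h1.eventually_lt_const hκ)
  refine ⟨N * (W₀ + N), fun n => ?_⟩
  rw [shadowTime]
  set k := Nat.log 2 n with hk
  rcases le_total N k with h | h
  · have h2 := hN k h
    have h3 : (0 : ℝ) < 2 ^ k := by positivity
    have h4 : W₀ * ((k : ℝ) ^ 1 / 2 ^ k) + (k : ℝ) ^ 2 / 2 ^ k = k * (W₀ + k) / 2 ^ k := by
      field_simp
    rw [h4, div_lt_iff₀ h3] at h2
    have h5 : (0 : ℝ) ≤ N * (W₀ + N) := by positivity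
    rcases eq_or_ne n 0 with rfl | hn
    · simp only [Nat.log_zero_right] at hk
      rw [hk]
      simp only [Nat.cast_zero, zero_mul, mul_zero, zero_add]
      exact h5
    · have h6 : (2 : ℝ) ^ k ≤ n := by exact_mod_cast Nat.pow_log_le_self 2 hn
      nlinarith
  · have h2 : (k : ℝ) ≤ N := by exact_mod_cast h
    have h3 : (k : ℝ) * (W₀ + k) ≤ N * (W₀ + N) := by gcongr
    have : 0 ≤ κ * n := by positivity
    linarith

/-- Following a digit sequence through nested good intervals gives a point whose orbit is bounded and
accumulates at `Λ`; points whose digits first differ at the `n`-th place are separated by a fixed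
proportion of the length of the intervals of level `n`. -/
lemma exists_digit_points {ε₀ : ℝ} {Λ : X} (hε₀ : 0 < ε₀)
    (hΛ : ∀ t : ℝ, LongVectors ε₀ (diagFlow t • Λ)) {M : ℕ} (hM : 2 ≤ M) {T : ℝ}
    (hT : Real.exp (2 * T) = 8 * M) :
    ∃ C ε₁ W₀ : ℝ, 0 < C ∧ 0 < ε₁ ∧ 0 < W₀ ∧ ∃ x : (ℕ → Fin M) → ℝ,
      (∀ d, ∀ s : ℝ, 0 ≤ s → LongVectors ε₁ (diagFlow s • latticeAt (x d))) ∧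
      (∀ d, ∀ j : ℕ, VisitsNear Λ (C * Real.exp (-j)) (T * j) (x d)) ∧
      ∀ (d d' : ℕ → Fin M) (n : ℕ), (∀ i < n, d i = d' i) → d n ≠ d' n →
        Real.exp (-2 * (n * T + shadowTime W₀ n)) / (8 * M) ≤ |x d - x d'| := by
  set ε : ℝ := min 1 (min (ε₀ / 4) (1 / (4 * Real.exp T))) with hεdef
  have hε : 0 < ε := by positivity
  have hεT : 4 * ε * Real.exp T ≤ 1 := by
    have : ε ≤ 1 / (4 * Real.exp T) := (min_le_right _ _).trans (min_le_right _ _)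
    rw [le_div_iff₀ (by positivity)] at this
    linarith
  obtain ⟨C, ε₁, W₀, hC, hε₁, hW₀, H⟩ := exists_children hΛ hε
    ((min_le_right _ _).trans (min_le_left _ _)) hM hT hεT
  have hM0 : (0 : ℝ) < 8 * M := by positivity
  have hT0 : 0 < T := by
    have h2 : (2 : ℝ) ≤ M := by exact_mod_cast hM
    have : 0 < 2 * T := by rw [← Real.one_lt_exp_iff, hT]; linarith
    linarith
  set t : ℕ → ℝ := fun n => n * T + shadowTime W₀ n with ht
  set w : ℕ → ℝ := fun n => shadowTime W₀ (n + 1) - shadowTime W₀ n with hw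
  have htw : ∀ n, t n + T + w n = t (n + 1) := fun n => by
    simp only [ht, hw]; push_cast; ring
  have hw0 : ∀ n, 0 ≤ w n := fun n => by
    rcases shadowTime_succ_sub W₀ hW₀ n with h | h
    · exact h.ge
    · exact hW₀.le.trans h
  have step : ∀ (n : ℕ) (a : ℝ), ∃ b : Fin M → ℝ, IsGood ε (t n) a → (∀ i, a ≤ b i ∧
        b i + Real.exp (-2 * t (n + 1)) ≤ a + Real.exp (-2 * t n) ∧ IsGood ε (t (n + 1)) (b i) ∧
        ∀ α ∈ Set.Icc (b i) (b i + Real.exp (-2 * t (n + 1))),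
          (∀ s : ℝ, t n ≤ s → s ≤ t (n + 1) → LongVectors ε₁ (diagFlow s • latticeAt α)) ∧
          (W₀ ≤ w n → VisitsNear Λ (C * Real.exp (-w n)) (t n) α)) ∧
      ∀ i j, i < j → b i + Real.exp (-2 * t (n + 1)) + Real.exp (-2 * t n) / (8 * M) ≤ b j := by
    intro n a
    by_cases hgood : IsGood ε (t n) a
    · obtain ⟨b, hb⟩ := H (w n) (shadowTime_succ_sub W₀ hW₀ n) (t n) a hgood
      rw [htw] at hb
      exact ⟨b, fun _ => hb⟩
    · exact ⟨fun _ => 0, fun h => absurd h hgood⟩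
  choose f hf using step
  -- The left end of the interval of level `n` chosen by the first `n` digits of `d`.
  set a : (ℕ → Fin M) → ℕ → ℝ := fun d n => Nat.rec 0 (fun n a => f n a (d n)) n with ha
  have ha_succ : ∀ d n, a d (n + 1) = f n (a d n) (d n) := fun d n => rfl
  have hgood : ∀ d n, IsGood ε (t n) (a d n) := by
    intro d n
    induction n with
    | zero =>
      have : t 0 = 0 := by simp [ht, shadowTime]
      rw [this]
      exact isGood_zero (min_le_left _ _)
    | succ n ih => rw [ha_succ]; exact ((hf n _ ih).1 (d n)).2.2.1
  have hcongr : ∀ d d' n, (∀ i < n, d i = d' i) → a d n = a d' n := by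
    intro d d' n
    induction n with
    | zero => intro _; rfl
    | succ n ih =>
      intro h
      rw [ha_succ, ha_succ, ih fun i hi => h i (by omega), h n (by omega)]
  have hanti : ∀ d, Antitone fun n => Set.Icc (a d n) (a d n + Real.exp (-2 * t n)) := by
    intro d
    refine antitone_nat_of_succ_le fun n => ?_
    obtain ⟨h1, h2, -⟩ := (hf n _ (hgood d n)).1 (d n)
    exact Set.Icc_subset_Icc h1 h2
  set x : (ℕ → Fin M) → ℝ := fun d => ⨆ n, a d n with hx
  have hmem : ∀ d n, x d ∈ Set.Icc (a d n) (a d n + Real.exp (-2 * t n)) := by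
    intro d n
    exact Set.mem_iInter.1 (ciSup_mem_iInter_Icc_of_antitone_Icc (hanti d)
      fun n => by linarith [Real.exp_pos (-2 * t n)]) n
  have hmem' : ∀ d n, x d ∈ Set.Icc (f n (a d n) (d n))
      (f n (a d n) (d n) + Real.exp (-2 * t (n + 1))) := fun d n => hmem d (n + 1)
  have htn : ∀ n : ℕ, n * T ≤ t n := fun n => by
    simp only [ht]; linarith [shadowTime_nonneg hW₀ n]
  refine ⟨C, ε₁, W₀, hC, hε₁, hW₀, x, ?_, ?_, ?_⟩
  · intro d s hs
    have hex : ∃ n, s ≤ t (n + 1) := by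
      obtain ⟨n, hn⟩ := exists_nat_ge (s / T)
      rw [div_le_iff₀ hT0] at hn
      refine ⟨n, hn.trans ((htn n).trans ?_)⟩
      rw [← htw]; linarith [hw0 n]
    classical
    refine (((hf (Nat.find hex) _ (hgood d _)).1 (d _)).2.2.2 _ (hmem' d _)).1 s ?_
      (Nat.find_spec hex)
    rcases hm : Nat.find hex with _ | m
    · simpa [ht, shadowTime] using hs
    · exact (not_le.1 (Nat.find_min hex (by omega : m < Nat.find hex))).le
  · intro d j
    have hwj := le_shadowTime_succ_sub W₀ hW₀ j
    set n := 2 ^ (j + 1) - 1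
    have hnj : (j : ℝ) ≤ n := by
      have : j + 1 < 2 ^ (j + 1) := Nat.lt_two_pow_self
      exact_mod_cast (by omega : j ≤ n)
    change W₀ + j ≤ w n at hwj
    obtain ⟨s, p, q, hs, hp, hq, heq⟩ := (((hf n _ (hgood d n)).1 (d n)).2.2.2 _ (hmem' d n)).2
      (by linarith [(Nat.cast_nonneg j : (0 : ℝ) ≤ j)])
    have hexp : C * Real.exp (-w n) ≤ C * Real.exp (-j) := by
      gcongr; linarith
    refine ⟨s, p, q, ?_, hp.trans hexp, hq.trans hexp, heq⟩
    have := htn n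
    nlinarith
  · intro d d' n hn hne
    have haa := hcongr d d' n hn
    have h1 := hmem' d n
    have h2 := hmem' d' n
    have hsep := (hf n _ (hgood d n)).2
    rw [← haa] at h2
    rcases lt_or_gt_of_ne hne with h | h
    · rw [abs_sub_comm]
      refine le_trans ?_ (le_abs_self _)
      linarith [hsep _ _ h, h1.2, h2.1]
    · refine le_trans ?_ (le_abs_self _)
      linarith [hsep _ _ h, h1.1, h2.2]

/-- Matrices close to the identity decrease the norm `ν` by at most a factor close to `1`. -/
lemma exists_mul_seminorm_le {ν : Seminorm ℝ (Fin 2 → ℝ)} (hν : ∀ v, ν v = 0 → v = 0) {c : ℝ}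
    (hc : c < 1) : ∃ δ : ℝ, 0 < δ ∧ ∀ a b : ℝ, |a| ≤ δ → |b| ≤ δ → ∀ v : Fin 2 → ℝ,
      c * ν v ≤ ν ((unip a : Matrix (Fin 2) (Fin 2) ℝ) *ᵥ
        ((lowUnip b : Matrix (Fin 2) (Fin 2) ℝ) *ᵥ v)) := by
  obtain ⟨K, hK, hKv⟩ := exists_seminorm_le_mul_norm ν
  obtain ⟨K', hK', hKv'⟩ := exists_norm_le_mul_seminorm hν
  set δ := min 1 ((1 - c) / (3 * K * K')) with hδ
  have hδ0 : 0 < δ := by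
    have : 0 < 1 - c := by linarith
    positivity
  have hδ1 : δ ≤ 1 := min_le_left _ _
  have hδc : 3 * K * K' * δ ≤ 1 - c := by
    have := min_le_right 1 ((1 - c) / (3 * K * K'))
    rw [← hδ, le_div_iff₀ (by positivity)] at this
    linarith
  refine ⟨δ, hδ0, fun a b ha hb v => ?_⟩
  set u := (unip a : Matrix (Fin 2) (Fin 2) ℝ) *ᵥ
    ((lowUnip b : Matrix (Fin 2) (Fin 2) ℝ) *ᵥ v) with hu
  have h0 : |v 0| ≤ ‖v‖ := norm_le_pi_norm v 0
  have h1 : |v 1| ≤ ‖v‖ := norm_le_pi_norm v 1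
  have hbv : |b * v 0| ≤ δ * ‖v‖ := by rw [abs_mul]; gcongr
  have hdiff : ‖v - u‖ ≤ 3 * δ * ‖v‖ := by
    have hpos : 0 ≤ δ * ‖v‖ := by positivity
    have e0 : (v - u) 0 = -(a * (b * v 0 + v 1)) := by
      rw [hu, lowUnip_mulVec, unip_mulVec]; simp
    have e1 : (v - u) 1 = -(b * v 0) := by
      rw [hu, lowUnip_mulVec, unip_mulVec]; simp
    rw [norm_eq_max, e0, e1, abs_neg, abs_neg]
    refine max_le ?_ (by linarith)
    have h2 : |b * v 0 + v 1| ≤ 2 * ‖v‖ := by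
      refine (abs_add_le _ _).trans ?_
      nlinarith [norm_nonneg v]
    rw [abs_mul]
    calc |a| * |b * v 0 + v 1| ≤ δ * (2 * ‖v‖) := by gcongr
      _ ≤ _ := by linarith
  have h3 : ν v ≤ ν u + ν (v - u) := by
    have := map_add_le_add ν u (v - u)
    rwa [add_sub_cancel] at this
  have h4 : ν (v - u) ≤ (1 - c) * ν v := by
    calc ν (v - u) ≤ K * ‖v - u‖ := hKv _
      _ ≤ K * (3 * δ * (K' * ν v)) := by
        gcongr
        exact hdiff.trans (by gcongr; exact hKv' v)
      _ = 3 * K * K' * δ * ν v := by ring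
      _ ≤ _ := by gcongr
  linarith

lemma not_mem_DI_of_visitsNear {ν : Seminorm ℝ (Fin 2 → ℝ)} (hν : ∀ v, ν v = 0 → v = 0) {Λ : X}
    (hΛ : Λ ∈ criticalLocus ν) {α : ℝ}
    (h : ∀ δ : ℝ, 0 < δ → ∀ s₀ : ℝ, VisitsNear Λ δ s₀ α) : α ∉ DI ν := by
  obtain ⟨hr, hcrit⟩ := vectors_inter_ball_eq_iff.1 hΛ
  refine not_mem_DI_iff.2 ⟨hr, fun c hc0 hc1 s₀ => ?_⟩
  obtain ⟨δ, hδ, hclose⟩ := exists_mul_seminorm_le hν hc1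
  obtain ⟨s, a, b, hs, ha, hb, heq⟩ := h δ hδ s₀
  refine ⟨s, hs, ?_⟩
  rw [heq]
  refine forall_vectors_smul.2 (forall_vectors_smul.2 fun v hv hv0 => ?_)
  refine le_trans ?_ (hclose a b ha hb v)
  gcongr
  exact hcrit v hv hv0

open scoped NNReal ENNReal in
lemma le_dimH_BA_diff_DI {ν : Seminorm ℝ (Fin 2 → ℝ)} (hν : ∀ v, ν v = 0 → v = 0) {Λ : X}
    (hΛ : Λ ∈ criticalLocus ν) (hΛ' : HasPrecompactOrbit Λ) {σ : ℝ≥0} (hσ0 : 0 < σ)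
    (hσ1 : σ < 1) : (σ : ℝ≥0∞) ≤ dimH (BA \ DI ν) := by
  obtain ⟨ε₀, hε₀, horbit⟩ := hΛ'.exists_longVectors
  have hσ0' : (0 : ℝ) < σ := by exact_mod_cast hσ0
  have hσ1' : (σ : ℝ) < 1 := by exact_mod_cast hσ1
  -- Each branching keeps `M` of `8M` equal subintervals; for large `M` this costs little dimension.
  obtain ⟨M, hM, hMσ⟩ : ∃ M : ℕ, 2 ≤ M ∧ (σ : ℝ) * Real.log (8 * M) < Real.log M := by
    have h1 : Filter.Tendsto (fun M : ℕ => Real.log M) Filter.atTop Filter.atTop :=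
      Real.tendsto_log_atTop.comp tendsto_natCast_atTop_atTop
    obtain ⟨M, h2, h3⟩ := ((h1.eventually_gt_atTop (σ * Real.log 8 / (1 - σ))).and
      (Filter.eventually_ge_atTop 2)).exists
    refine ⟨M, h3, ?_⟩
    have hM0 : (M : ℝ) ≠ 0 := by
      have : (2 : ℝ) ≤ M := by exact_mod_cast h3
      linarith
    rw [div_lt_iff₀ (by linarith)] at h2
    rw [Real.log_mul (by norm_num) hM0]
    linarith
  have hM0 : (0 : ℝ) < M := by
    have : (2 : ℝ) ≤ M := by exact_mod_cast hM
    linarith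
  set T := Real.log (8 * M) / 2 with hTdef
  have hT : Real.exp (2 * T) = 8 * M := by
    rw [hTdef, mul_div_cancel₀ _ two_ne_zero, Real.exp_log (by positivity)]
  have hT0 : 0 < T := by
    have h1 : (2 : ℝ) ≤ M := by exact_mod_cast hM
    have : 0 < Real.log (8 * M) := Real.log_pos (by linarith)
    positivity
  obtain ⟨C, ε₁, W₀, hC, hε₁, hW₀, x, hx1, hx2, hx3⟩ := exists_digit_points hε₀ horbit hM hT
  have hsub : Set.range x ⊆ BA \ DI ν := by
    rintro _ ⟨d, rfl⟩
    refine ⟨mem_BA_iff.2 ⟨ε₁, hε₁, hx1 d⟩, not_mem_DI_of_visitsNear hν hΛ fun δ hδ s₀ => ?_⟩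
    have h1 : Filter.Tendsto (fun j : ℕ => C * Real.exp (-j)) Filter.atTop (nhds (C * 0)) :=
      (Real.tendsto_exp_neg_atTop_nhds_zero.comp tendsto_natCast_atTop_atTop).const_mul C
    rw [mul_zero] at h1
    obtain ⟨j, h2, h3⟩ := ((h1.eventually_lt_const hδ).and
      (((tendsto_natCast_atTop_atTop (R := ℝ)).const_mul_atTop hT0).eventually_ge_atTop s₀)).exists
    obtain ⟨s, p, q, hs, hp, hq, heq⟩ := hx2 d j
    exact ⟨s, p, q, h3.trans hs, hp.trans h2.le, hq.trans h2.le, heq⟩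
  refine le_trans ?_ (dimH_mono hsub)
  set η := Real.log M - σ * Real.log (8 * M) with hη
  have hη0 : 0 < η := by linarith
  obtain ⟨B, hB⟩ := exists_shadowTime_le W₀ hW₀ (κ := η / (2 * σ)) (by positivity)
  set K := Real.exp (2 * σ * B + σ * Real.log (8 * M)) with hK
  refine le_dimH_range_of_digits (K := ⟨K, (Real.exp_pos _).le⟩) (by omega) hσ0
    fun d d' n hn hne => ?_
  have h1 := hx3 d d' n hn hne
  have h2 : (Real.exp (-2 * (n * T + shadowTime W₀ n)) / (8 * M)) ^ (σ : ℝ) ≤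
      |x d - x d'| ^ (σ : ℝ) := Real.rpow_le_rpow (by positivity) h1 hσ0'.le
  change ((M : ℝ) ^ n)⁻¹ ≤ K * |x d - x d'| ^ (σ : ℝ)
  refine le_trans ?_ (mul_le_mul_of_nonneg_left h2 (Real.exp_pos _).le)
  have h3 : Real.exp (-2 * (n * T + shadowTime W₀ n)) / (8 * M) =
      Real.exp (-2 * (n * T + shadowTime W₀ n) - Real.log (8 * M)) := by
    rw [Real.exp_sub, Real.exp_log (by positivity)]
  have h4 : ((M : ℝ) ^ n)⁻¹ = Real.exp (-(n * Real.log M)) := by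
    rw [Real.exp_neg, Real.exp_nat_mul, Real.exp_log hM0]
  rw [h3, h4, ← Real.exp_mul, hK, ← Real.exp_add]
  refine Real.exp_le_exp.2 ?_
  have h5 : 2 * σ * shadowTime W₀ n ≤ η * n + 2 * σ * B := by
    have := mul_le_mul_of_nonneg_left (hB n) (by positivity : (0 : ℝ) ≤ 2 * σ)
    have h6 : 2 * (σ : ℝ) * (η / (2 * σ) * n + B) = η * n + 2 * σ * B := by
      field_simp
    linarith
  have h7 : 2 * T = Real.log (8 * M) := by rw [hTdef]; ring
  have h8 : η * n = n * Real.log M - σ * (n * (2 * T)) := by rw [hη, h7]; ring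
  linarith

end NormDirichlet

/-- The dichotomy, for an arbitrary norm `ν` on `ℝ²`. -/
theorem mainTheorem2 (ν : Seminorm ℝ (Fin 2 → ℝ)) (hν : ∀ v : Fin 2 → ℝ, ν v = 0 → v = 0) :
    ((∃ Λ ∈ NormDirichlet.criticalLocus ν, NormDirichlet.HasPrecompactOrbit Λ) →
      dimH (NormDirichlet.BA \ NormDirichlet.DI ν) = 1) ∧
    ((¬ ∃ Λ ∈ NormDirichlet.criticalLocus ν, NormDirichlet.HasPrecompactOrbit Λ) →
      NormDirichlet.BA ⊆ NormDirichlet.DI ν) := by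
  refine ⟨?_, fun h α hα => ?_⟩
  · rintro ⟨Λ, hΛ, hΛ'⟩
    refine le_antisymm ((dimH_mono (Set.subset_univ _)).trans Real.dimH_univ.le) ?_
    refine le_of_forall_lt fun c hc => ?_
    obtain ⟨σ, h1, h2⟩ := ENNReal.lt_iff_exists_nnreal_btwn.1 hc
    refine h1.trans_le (NormDirichlet.le_dimH_BA_diff_DI hν hΛ hΛ' ?_ (by exact_mod_cast h2))
    exact_mod_cast (zero_le (a := c)).trans_lt h1
  · by_contra hDI
    exact h (NormDirichlet.exists_criticalLocus_of_mem_BA_diff_DI hα hDI)
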